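/- Let $G=(V,E,\sigma)$ be a signed graph ($G$ simple, $\sigma:E\to\{+1,-1\}$) with $n=|V|$. Write $T_1(G)$ for the number of triangles with exactly one positive edge, and $\Delta_E(G)$, $\Delta_V(G)$ for the maximum number of triangles (of any sign type) containing a given edge, respectively a given vertex. In an insertion-only stream of $G$ each edge arrives exactly once, together with its sign, in an arbitrary order. The signed Jayaram–Kallaugher estimator with sampling probabilities $p_V,p_E\in(0,1]$ uses a hash $h_V:V\to\{0,1\}$, drawn from a finite pairwise independent family with $\Pr[h_V(u)=1]=p_V$ and kept in memory, and independent bits $h_E(e)$ with $\Pr[h_E(e)=1]=p_E$, each drawn when $e$ arrives. It starts with $R_1=0$ and an empty dictionary $S$. When $(vw,\sigma_{vw})$ arrives, it adds $1/(p_Vp_E^2)$ to $R_1$ for each $u$ such that $h_V(u)=1$, $uv,uw\in S$ and either $\sigma_{vw}=+1$, $S[uv]=S[uw]=-1$, or $\sigma_{vw}=-1$, $S[uv]\ne S[uw]$; then, if $h_E(vw)=1$ and ($h_V(v)=1$ or $h_V(w)=1$), it sets $S[vw]=\sigma_{vw}$. The median-of-means algorithm built on it runs $N_\delta$ groups of $N_\epsilon$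 independent copies in parallel and outputs the median over the groups of the mean of $R_1$ in each group; a group whose copies come to store more than a fixed number $B$ of edges in total is abandoned and contributes the value $0$. There is an absolute constant $C>0$ such that the following holds for all integers $n,\bar m,\bar\Delta_E,\bar\Delta_V\ge 0$ and $\bar T\ge1$ and all $\epsilon\in(0,1]$, $\delta\in(0,1/2]$. There are $p_V,p_E$, a pairwise independent family and $N_\epsilon,N_\delta\ge1$, $B\ge0$ such that, for every signed graph $G$ on $n$ vertices with $$|E|\le\bar m,\qquad T_1(G)\ge\bar T,\qquad \Delta_E(G)\le\bar\Delta_E,\qquad \Delta_V(G)\le\bar\Delta_V$$ and every insertion-only stream of $G$, the median-of-means algorithm with these parameters outputs $R$ with $$\Pr\bigl[\,|R-T_1(G)|\le\epsilon\,T_1(G)\,\bigr]\ge1-\delta ,$$ and on all these streams, at all times and for all outcomes of its random choices, its memory is held in at most $$C\,\frac{\bar m}{\bar T}\left(\bar\Delta_E+\sqrt{\bar\Delta_V}\right)\log n\;\frac1{\epsilon^2}\log\frac1\delta$$ bits. In particular, if $\bar m,\bar T,\bar\Delta_E,\bar\Delta_V$ agree with $|E|,T_1(G),\Delta_E(G),\Delta_V(G)$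 up to constant factors, the space is $O\bigl(\frac{m}{T_1}(\Delta_E+\sqrt{\Delta_V})\log n\,\frac1{\epsilon^2}\log\frac1\delta\bigr)$ bits, where $m=|E|$. -/

import Mathlib

open MeasureTheory

namespace SignedStream

/-! ### Signed graphs, signed triangles and the graph parameters -/

/-- A signed graph on the vertex set `{0, …, n-1}`: a simple graph with a sign in `{+1, -1}` on
each edge.  Only the values of `sign` on edges of `graph` are ever used. -/
structure SignedGraph (n : ℕ) where
  graph : SimpleGraph (Fin n)
  sign : Sym2 (Fin n) → ℤˣ

namespace SignedGraph

variable {n : ℕ} (G : SignedGraph n)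

/-- The triangles of `G`, as sets of three pairwise adjacent vertices. -/
def triangles : Set (Finset (Fin n)) := {t | G.graph.IsNClique 3 t}

/-- The positive edges of `G` with both endpoints in `t`. -/
def positiveEdgesIn (t : Finset (Fin n)) : Set (Sym2 (Fin n)) :=
  {e | e ∈ G.graph.edgeSet ∧ (∀ x ∈ e, x ∈ t) ∧ G.sign e = 1}

/-- `T_j`: the number of triangles with exactly `j` positive edges. -/
noncomputable def numTriangles (j : ℕ) : ℕ :=
  {t | t ∈ G.triangles ∧ (G.positiveEdgesIn t).ncard = j}.ncard

/-- `m`: the number of edges. -/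
noncomputable def numEdges : ℕ := G.graph.edgeSet.ncard

/-- `Δ_E`: the maximum number of triangles containing a given edge. -/
noncomputable def maxTrianglesAtEdge : ℕ :=
  ⨆ e : G.graph.edgeSet, {t | t ∈ G.triangles ∧ ∀ x ∈ (e : Sym2 (Fin n)), x ∈ t}.ncard

/-- `Δ_V`: the maximum number of triangles containing a given vertex. -/
noncomputable def maxTrianglesAtVertex : ℕ :=
  ⨆ v : Fin n, {t | t ∈ G.triangles ∧ v ∈ t}.ncard

end SignedGraph

/-- An element `(vw, σ)` of a signed edge stream. -/
structure SignedEdge (n : ℕ) where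
  v : Fin n
  w : Fin n
  sign : ℤˣ

/-- The underlying unordered pair `vw`. -/
def SignedEdge.edge {n : ℕ} (a : SignedEdge n) : Sym2 (Fin n) := s(a.v, a.w)

/-- `l` is an insertion-only stream of `G`: each edge of `G` arrives exactly once, with its sign,
in an arbitrary order (and with its endpoints in an arbitrary order). -/
def IsStreamOf {n : ℕ} (l : List (SignedEdge n)) (G : SignedGraph n) : Prop :=
  (l.map SignedEdge.edge).Nodup ∧
  (∀ e, e ∈ l.map SignedEdge.edge ↔ e ∈ G.graph.edgeSet) ∧
  ∀ a ∈ l, a.sign = G.sign a.edge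

/-! ### Randomized single-pass streaming algorithms and their space -/

/-- A randomized single-pass streaming algorithm for streams over `α`.  The initial memory may
depend on an initial random draw, and each update may use the current memory, the arriving item
and a fresh random draw, and nothing else; in particular whatever is needed of earlier items or
draws has to be kept in the memory.  The output is read off the final memory. -/
structure StreamAlg (α Seed Coin Mem : Type) where
  init : Seed → Mem
  step : Mem → α → Coin → Mem
  out : Mem → ℝ

namespace StreamAlg

variable {α Seed Coin Mem : Type} (A : StreamAlg α Seed Coin Mem)

/-- The memory after reading the stream `l`, where `c i` is the draw made when the `i`-th item
arrives. -/
def run (l : List α) (s : Seed) (c : Fin l.length → Coin) : Mem :=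
  (List.finRange l.length).foldl (fun M i => A.step M (l.get i) (c i)) (A.init s)

/-- Memory contents that can occur at some time during the processing of a stream in `P`. -/
def reachable (P : Set (List α)) : Set Mem :=
  {M | ∃ l ∈ P, ∃ l' : List α, l' <+: l ∧
    ∃ (s : Seed) (c : Fin l'.length → Coin), M = A.run l' s c}

/-- On all streams in `P`, at all times and for all outcomes of the random draws, the memory
contents can be held in `b` bits. -/
def UsesAtMostBits (P : Set (List α)) (b : ℕ) : Prop :=
  ∃ enc : Mem → (Fin b → Bool), Set.InjOn enc (A.reachable P)

/-- The probability that the output on the stream `l` lies in `E`, when the initial draw has law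
`μ` and the draws made at the arrivals have law `ν`, all of them independent. -/
noncomputable def outProb [MeasurableSpace Seed] [MeasurableSpace Coin]
    (μ : Measure Seed) (ν : Measure Coin) (l : List α) (E : Set ℝ) : ENNReal :=
  (μ.prod (Measure.pi fun _ : Fin l.length => ν)) {ω | A.out (A.run l ω.1 ω.2) ∈ E}

end StreamAlg

/-! ### The signed triangle estimator -/

/-- The data of a median-of-means algorithm built on the estimator below: the sampling
probabilities `pV`, `pE`, a pairwise independent family `hV` of `numSeeds` hash functions on the
vertices with marginal probability `pV` (one of them is drawn uniformly, and its index is stored),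
the number `numMean` of runs that are averaged in a group, the number `numGroups` of groups of
which the median is taken, and the number `budget` of edges which a group may store before it is
abandoned. -/
structure Params (n : ℕ) where
  pV : ℝ
  pE : ℝ
  pV_pos : 0 < pV
  pV_le : pV ≤ 1
  pE_pos : 0 < pE
  pE_le : pE ≤ 1
  numSeeds : ℕ
  numSeeds_pos : 0 < numSeeds
  hV : Fin numSeeds → Fin n → Bool
  hV_marginal : ∀ u, ({k | hV k u = true} : Set (Fin numSeeds)).ncard = pV * numSeeds
  hV_pairwise : ∀ u w, u ≠ w →
    ({k | hV k u = true ∧ hV k w = true} : Set (Fin numSeeds)).ncard = pV ^ 2 * numSeeds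
  numMean : ℕ
  numMean_pos : 0 < numMean
  numGroups : ℕ
  numGroups_pos : 0 < numGroups
  budget : ℕ

variable {n : ℕ}

/-- Memory of one run of the estimator: the hash function `h_V` (given by its index), the running
estimate `R₁`, and the dictionary `S` of stored edges and their signs. -/
structure EstMem (θ : Params n) where
  seed : Fin θ.numSeeds
  R : ℝ
  S : Sym2 (Fin n) → Option ℤˣ

/-- At the start `R₁ = 0` and `S` is empty. -/
def estInit (θ : Params n) (k : Fin θ.numSeeds) : EstMem θ := ⟨k, 0, fun _ => none⟩

/-- The vertices `u` at which the arriving edge `a = (vw, σ)` is found to complete a triangle with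
exactly one positive edge: `h_V(u) = 1`, the edges `uv` and `uw` are stored, and either `σ = +1`
and both stored signs are `-1`, or `σ = -1` and the stored signs differ. -/
def detected {θ : Params n} (M : EstMem θ) (a : SignedEdge n) : Set (Fin n) :=
  {u | θ.hV M.seed u = true ∧
    ∃ x y : ℤˣ, M.S s(u, a.v) = some x ∧ M.S s(u, a.w) = some y ∧
      ((a.sign = 1 ∧ x = -1 ∧ y = -1) ∨ (a.sign = -1 ∧ x ≠ y))}

/-- Processing of the edge `a = (vw, σ)`: first `R₁` grows by `1 / (p_V p_E²)` for every detected
triangle, then `S[vw]` is set to `σ` if `h_E(vw) = 1` and (`h_V(v) = 1` or `h_V(w) = 1`).  The bit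
`hE = h_E(vw)` is a fresh one, as every edge arrives only once. -/
noncomputable def estStep {θ : Params n} (M : EstMem θ) (a : SignedEdge n) (hE : Bool) :
    EstMem θ where
  seed := M.seed
  R := M.R + (detected M a).ncard * (1 / (θ.pV * θ.pE ^ 2))
  S := if hE = true ∧ (θ.hV M.seed a.v = true ∨ θ.hV M.seed a.w = true)
    then Function.update M.S a.edge (some a.sign) else M.S

/-- The number of stored edges. -/
noncomputable def EstMem.numStored {θ : Params n} (M : EstMem θ) : ℕ :=
  {e | M.S e ≠ none}.ncard

/-! ### Median of means -/

/-- The median of finitely many real numbers (the mean of the two middle ones if their number is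
even). -/
noncomputable def median {k : ℕ} (x : Fin k → ℝ) : ℝ :=
  if h : 0 < k then
    (x (Tuple.sort x ⟨(k - 1) / 2, by omega⟩) + x (Tuple.sort x ⟨k / 2, by omega⟩)) / 2
  else 0

/-- Memory of one group: that of its `numMean` runs, or `none` once the group is abandoned. -/
abbrev GroupMem (θ : Params n) : Type := Option (Fin θ.numMean → EstMem θ)

/-- All runs of a group read the edge `a`, with separate bits `hE j`; the group is abandoned as
soon as its runs store more than `budget` edges in total. -/
noncomputable def groupStep {θ : Params n} (M : GroupMem θ) (a : SignedEdge n)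
    (hE : Fin θ.numMean → Bool) : GroupMem θ :=
  match M with
  | none => none
  | some f =>
    if ∑ j, (estStep (f j) a (hE j)).numStored ≤ θ.budget
    then some fun j => estStep (f j) a (hE j) else none

/-- The mean of the estimates of a group (zero if the group was abandoned). -/
noncomputable def groupMean {θ : Params n} (M : GroupMem θ) : ℝ :=
  match M with
  | none => 0
  | some f => (∑ j, (f j).R) / θ.numMean

/-- The median-of-means algorithm with the estimator as a subroutine: all runs in all groups
process the stream in parallel, and the output is the median over the groups of the group means. -/
noncomputable def medianOfMeans (θ : Params n) :
    StreamAlg (SignedEdge n) (Fin θ.numGroups → Fin θ.numMean → Fin θ.numSeeds)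
      (Fin θ.numGroups → Fin θ.numMean → Bool) (Fin θ.numGroups → GroupMem θ) where
  init k := fun g => some fun j => estInit θ (k g j)
  step M a hE := fun g => groupStep (M g) a (hE g)
  out M := median fun g => groupMean (M g)

/-- The law of the hash functions `h_V` of all runs: independent and uniform in the family. -/
noncomputable def seedLaw (θ : Params n) :
    Measure (Fin θ.numGroups → Fin θ.numMean → Fin θ.numSeeds) :=
  Measure.pi fun _ => Measure.pi fun _ => ProbabilityTheory.uniformOn Set.univ

/-- The Bernoulli law on `{0, 1}` with success probability `p`. -/
noncomputable def bernoulliLaw (p : ℝ) : Measure Bool :=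
  ENNReal.ofReal p • Measure.dirac true + ENNReal.ofReal (1 - p) • Measure.dirac false

/-- The law of the bits `h_E(vw)` of all runs for one arriving edge: independent, each of them
equal to `1` with probability `p_E`. -/
noncomputable def coinLaw (θ : Params n) : Measure (Fin θ.numGroups → Fin θ.numMean → Bool) :=
  Measure.pi fun _ => Measure.pi fun _ => bernoulliLaw θ.pE

/-! ### The a priori bounds -/

/-- The signed graphs on `n` vertices with at most `m` edges, at least `T` triangles with exactly
one positive edge, at most `DE` triangles on any edge and at most `DV` triangles on any vertex. -/
def boundedGraphs (n m T DE DV : ℕ) : Set (SignedGraph n) :=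
  {G | G.numEdges ≤ m ∧ T ≤ G.numTriangles 1 ∧
    G.maxTrianglesAtEdge ≤ DE ∧ G.maxTrianglesAtVertex ≤ DV}

end SignedStream

/-!
The estimate of a run is `1 / (p_V p_E²)` times the number of sampled triangles: a triangle `uvw`
with exactly one positive edge whose last edge `vw` arrives at time `i` is counted if and only if
`h_V(u) = 1` and both bits drawn at the arrivals of `uv` and `uw` are `1`. Every triangle is closed
exactly once, so the estimate is unbiased. The events of two triangles are correlated only if these
have a common apex `u` or a common leg. For a given triangle, at most `min(Δ_V, m)` triangles have
the same apex, and at most `2 Δ_E` contain one of its two legs. Hence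
`Var R₁ ≤ T₁ (min(Δ_V, m) / p_V + 2 Δ_E / (p_V p_E) + 1 / (p_V p_E²))`.

With `s = √min(Δ_V, m)` and `p_E = 1 / s`, the variance of a group mean is at most `ε² T₁² / 32` as
soon as `N_ε p_V ≥ 64 s (Δ_E + s) / (ε² T)`. A group then stores about
`N_ε p_V p_E m ≈ (Δ_E + s) m / (ε² T)` edges, so that by the inequalities of Markov and Chebyshev
it is abandoned or inaccurate with a small constant probability, which the median amplifies.

The logarithmic number of bits per stored edge comes from counting memory states: families of `N`
dictionaries on at most `n²` edges with `B` entries in total number at most `(2n²)^B 4^N`, and the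
estimate of a run is encoded by its number of detected triangles, which is at most `n³`.
-/

namespace SignedStream

open ProbabilityTheory

section Median

theorem mem_of_monotone_of_card_notMem_lt {α : Type*} [Preorder α] {k : ℕ} {y : Fin k → α}
    (hy : Monotone y) {S : Set α} [DecidablePred (· ∈ S)] [hS : S.OrdConnected]
    (hbad : 2 * (Finset.univ.filter fun i => y i ∉ S).card < k) {r : Fin k}
    (hlower : k ≤ 2 * (r + 1)) (hupper : 2 * (r : ℕ) ≤ k) : y r ∈ S := by
  have exists_mem (I : Finset (Fin k)) (hI : k ≤ 2 * I.card) : ∃ i ∈ I, y i ∈ S := by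
    by_contra! h
    have : I.card ≤ (Finset.univ.filter fun i => y i ∉ S).card :=
      Finset.card_le_card fun i hi => Finset.mem_filter.2 ⟨Finset.mem_univ i, h i hi⟩
    omega
  obtain ⟨i, hir, hi⟩ := exists_mem (Finset.Iic r) (by rwa [Fin.card_Iic])
  obtain ⟨j, hrj, hj⟩ := exists_mem (Finset.Ici r) (by rw [Fin.card_Ici]; omega)
  exact hS.out hi hj ⟨hy (Finset.mem_Iic.1 hir), hy (Finset.mem_Ici.1 hrj)⟩

theorem median_mem_of_card_notMem_lt {k : ℕ} {x : Fin k → ℝ} {S : Set ℝ}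
    [DecidablePred (· ∈ S)] [hS : S.OrdConnected]
    (hbad : 2 * (Finset.univ.filter fun i => x i ∉ S).card < k) : median x ∈ S := by
  have hk : 0 < k := by omega
  have hsorted : (Finset.univ.filter fun i => x (Tuple.sort x i) ∉ S).card =
      (Finset.univ.filter fun i => x i ∉ S).card :=
    Finset.card_equiv (Tuple.sort x) (by simp)
  rw [← hsorted] at hbad
  have hmid {r : Fin k} := mem_of_monotone_of_card_notMem_lt (r := r) (Tuple.monotone_sort x) hbad
  have hleft := @hmid ⟨(k - 1) / 2, by omega⟩ (by dsimp only; omega) (by dsimp only; omega)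
  have hright := @hmid ⟨k / 2, by omega⟩ (by dsimp only; omega) (by dsimp only; omega)
  rw [median, dif_pos hk, div_eq_inv_mul, ← invOf_eq_inv, ← smul_eq_mul, ← midpoint_eq_smul_add]
  exact hS.convex.midpoint_mem hleft hright

end Median

section ProductMeasure

variable {Ω ι : Type*} [MeasurableSpace Ω] [Fintype ι] (μ : Measure Ω) [IsProbabilityMeasure μ]

theorem measure_pi_card_le_two_mul_card_mem {B : Set Ω} [DecidablePred (· ∈ B)] {r : ENNReal}
    (hr : r ≤ 1) (hB : μ B ≤ r ^ 2) :
    Measure.pi (fun _ : ι => μ)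
        {ω | Fintype.card ι ≤ 2 * (Finset.univ.filter fun g => ω g ∈ B).card} ≤
      (2 * r) ^ Fintype.card ι := by
  classical
  set large := Finset.univ.filter fun I : Finset ι => Fintype.card ι ≤ 2 * I.card
  have hcover : {ω : ι → Ω | Fintype.card ι ≤ 2 * (Finset.univ.filter fun g => ω g ∈ B).card} ⊆
      ⋃ I ∈ large, Set.univ.pi fun g => if g ∈ I then B else Set.univ := by
    intro ω hω
    refine Set.mem_biUnion (x := Finset.univ.filter fun g => ω g ∈ B) (by simpa [large] using hω) ?_
    simp [Set.mem_ite_univ_right]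
  have hfixed : ∀ I ∈ large, Measure.pi (fun _ : ι => μ)
      (Set.univ.pi fun g => if g ∈ I then B else Set.univ) ≤ r ^ Fintype.card ι := by
    intro I hI
    calc _ = μ B ^ I.card := by
          rw [Measure.pi_pi]
          simp [apply_ite μ, Finset.prod_ite_mem]
      _ ≤ (r ^ 2) ^ I.card := by gcongr
      _ ≤ r ^ Fintype.card ι := by
          rw [← pow_mul]
          exact pow_le_pow_right_of_le_one' hr (Finset.mem_filter.1 hI).2
  calc _ ≤ ∑ I ∈ large, Measure.pi (fun _ : ι => μ)
          (Set.univ.pi fun g => if g ∈ I then B else Set.univ) :=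
        (measure_mono hcover).trans (measure_biUnion_finset_le _ _)
    _ ≤ ∑ _I ∈ large, r ^ Fintype.card ι := Finset.sum_le_sum hfixed
    _ ≤ ∑ _I : Finset ι, r ^ Fintype.card ι :=
        Finset.sum_le_sum_of_subset (Finset.filter_subset _ _)
    _ = (2 * r) ^ Fintype.card ι := by simp [mul_pow]

theorem measure_median_notMem_le {k : ℕ} (X : Ω → ℝ) {S : Set ℝ} [S.OrdConnected]
    {r : ENNReal} (hr : r ≤ 1) (hX : μ {ω | X ω ∉ S} ≤ r ^ 2) :
    Measure.pi (fun _ : Fin k => μ) {ω | (median fun g => X (ω g)) ∉ S} ≤ (2 * r) ^ k := by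
  classical
  calc _ ≤ Measure.pi (fun _ : Fin k => μ) {ω | Fintype.card (Fin k) ≤
          2 * (Finset.univ.filter fun g => ω g ∈ {ω | X ω ∉ S}).card} := by
        refine measure_mono fun ω hω => ?_
        rw [Set.mem_ofPred_eq, Fintype.card_fin]
        exact not_lt.1 fun h => hω (median_mem_of_card_notMem_lt h)
    _ ≤ (2 * r) ^ k := by
        simpa only [Fintype.card_fin] using
          measure_pi_card_le_two_mul_card_mem (ι := Fin k) (B := {ω | X ω ∉ S}) μ hr hX

theorem integral_pi_sum_comp_eval {X : Ω → ℝ} (hX : Integrable X μ) :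
    ∫ ω, ∑ j, X (ω j) ∂Measure.pi (fun _ : ι => μ) = Fintype.card ι * ∫ x, X x ∂μ := by
  rw [integral_finsetSum _ fun j _ => integrable_comp_eval hX]
  simp [integral_comp_eval (μ := fun _ : ι => μ) hX.aestronglyMeasurable]

theorem measure_pi_le_abs_mean_sub_integral [Nonempty ι] {X : Ω → ℝ} (hX : MemLp X 2 μ) {c : ℝ}
    (hc : 0 < c) :
    Measure.pi (fun _ : ι => μ)
        {ω | c ≤ |(∑ j, X (ω j)) / Fintype.card ι - ∫ x, X x ∂μ|} ≤
      ENNReal.ofReal (Var[X; μ] / (Fintype.card ι * c ^ 2)) := by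
  set P := Measure.pi fun _ : ι => μ
  have hsum : MemLp (fun ω : ι → Ω => ∑ j, X (ω j)) 2 P :=
    memLp_finsetSum _ fun j _ => hX.comp_measurePreserving (measurePreserving_eval _ j)
  have hmean : ∫ ω, (∑ j, X (ω j)) / Fintype.card ι ∂P = ∫ x, X x ∂μ := by
    rw [integral_div, integral_pi_sum_comp_eval μ (hX.integrable one_le_two)]
    field_simp
  have hvar : Var[fun ω => (∑ j, X (ω j)) / Fintype.card ι; P] = Var[X; μ] / Fintype.card ι := by
    have := variance_sum_pi (μ := fun _ : ι => μ) (X := fun _ => X) fun _ => hX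
    simp only [Finset.sum_fn, Finset.sum_const, Finset.card_univ, nsmul_eq_mul] at this
    simp only [div_eq_mul_inv]
    rw [variance_mul_const, this]
    field_simp
  have := meas_ge_le_variance_div_sq (hsum.mul_const (Fintype.card ι : ℝ)⁻¹) hc
  simp only [← div_eq_mul_inv] at this
  rwa [hmean, hvar, div_div] at this

theorem measure_pi_le_sum_le {X : Ω → ℝ} (hX : Integrable X μ) (hnonneg : 0 ≤ X) {c : ℝ}
    (hc : 0 < c) :
    Measure.pi (fun _ : ι => μ) {ω | c ≤ ∑ j, X (ω j)} ≤
      ENNReal.ofReal (Fintype.card ι * (∫ x, X x ∂μ) / c) := by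
  have := mul_meas_ge_le_integral_of_nonneg (μ := Measure.pi fun _ : ι => μ)
    (.of_forall fun ω => Finset.sum_nonneg fun j _ => hnonneg (ω j))
    (integrable_finsetSum Finset.univ fun j _ => integrable_comp_eval hX) c
  rw [integral_pi_sum_comp_eval μ hX] at this
  rw [← ofReal_measureReal]
  exact ENNReal.ofReal_le_ofReal ((le_div_iff₀' hc).2 this)

theorem map_pi_prod_pi_eq_pi_prod {κ L Ω' : Type*} [Fintype κ] [Fintype L] [MeasurableSpace Ω']
    [Countable Ω] [MeasurableSingletonClass Ω] [Countable Ω'] [MeasurableSingletonClass Ω']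
    (ν : Measure Ω') [IsProbabilityMeasure ν] :
    ((Measure.pi fun _ : κ => Measure.pi fun _ : ι => μ).prod
        (Measure.pi fun _ : L => Measure.pi fun _ : κ => Measure.pi fun _ : ι => ν)).map
          (fun ω g j => (ω.1 g j, fun i => ω.2 i g j)) =
      Measure.pi fun _ : κ => Measure.pi fun _ : ι => μ.prod (Measure.pi fun _ : L => ν) := by
  refine Measure.ext_of_singleton fun y => ?_
  rw [Measure.map_apply (by fun_prop) (measurableSet_singleton y)]
  have hpreimage : (fun (ω : (κ → ι → Ω) × (L → κ → ι → Ω')) g j => (ω.1 g j, fun i => ω.2 i g j))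
      ⁻¹' {y} = {fun g j => (y g j).1} ×ˢ {fun i g j => (y g j).2 i} := by
    ext ω
    simp only [Set.mem_preimage, Set.mem_singleton_iff, Set.mem_prod, funext_iff, Prod.ext_iff]
    grind
  have hrun (z : Ω × (L → Ω')) :
      μ.prod (Measure.pi fun _ : L => ν) {z} = μ {z.1} * ∏ i, ν {z.2 i} := by
    rw [← Set.singleton_prod_singleton, Measure.prod_prod, Measure.pi_singleton]
  simp only [hpreimage, Measure.prod_prod, Measure.pi_singleton, hrun, Finset.prod_mul_distrib]
  congr 1
  rw [Finset.prod_comm]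
  exact Finset.prod_congr rfl fun g _ => Finset.prod_comm

end ProductMeasure

section PairwiseIndependence

theorem ncard_preimage_equiv {α β : Type*} (e : α ≃ β) (S : Set β) :
    (e ⁻¹' S).ncard = S.ncard :=
  Set.ncard_preimage_of_injective_subset_range e.injective (by simp)

theorem ncard_affine_mem {R : Type*} [Ring R] (x : R) (S : Set R) :
    {p : R × R | p.1 * x + p.2 ∈ S}.ncard = Nat.card R * S.ncard := by
  let shear : R × R ≃ R × R := (Equiv.refl R).prodShear fun a => Equiv.addLeft (a * x)
  have hpreimage : {p : R × R | p.1 * x + p.2 ∈ S} = shear ⁻¹' Set.univ ×ˢ S := by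
    ext p
    simp [shear]
  rw [hpreimage, ncard_preimage_equiv, Set.ncard_prod, Set.ncard_univ]

theorem ncard_affine_mem_and_affine_mem {K : Type*} [Field K] {x y : K} (hxy : x ≠ y)
    (S S' : Set K) :
    {p : K × K | p.1 * x + p.2 ∈ S ∧ p.1 * y + p.2 ∈ S'}.ncard = S.ncard * S'.ncard := by
  have hxy : x - y ≠ 0 := sub_ne_zero.2 hxy
  let interpolate : K × K ≃ K × K :=
    { toFun p := (p.1 * x + p.2, p.1 * y + p.2)
      invFun z := ((z.1 - z.2) / (x - y), z.1 - (z.1 - z.2) / (x - y) * x)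
      left_inv p := by ext <;> simp only <;> field_simp <;> ring
      right_inv z := by ext <;> simp only <;> field_simp <;> ring }
  rw [← Set.ncard_prod]
  exact ncard_preimage_equiv interpolate (S ×ˢ S')

theorem exists_pairwiseIndependent (K : Type*) [Field K] [Finite K] {n k : ℕ}
    (hn : n ≤ Nat.card K) (hk : k ≤ Nat.card K) :
    ∃ hV : Fin (Nat.card K * Nat.card K) → Fin n → Bool,
      (∀ u, {s | hV s u = true}.ncard = Nat.card K * k) ∧
        ∀ u w, u ≠ w → {s | hV s u = true ∧ hV s w = true}.ncard = k * k := by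
  classical
  have e : Fin (Nat.card K * Nat.card K) ≃ K × K := (Finite.equivFinOfCardEq (by simp)).symm
  obtain ⟨x⟩ : Nonempty (Fin n ↪ K) := by
    have := Fintype.ofFinite K
    exact Function.Embedding.nonempty_of_card_le (by simpa using hn)
  obtain ⟨S, -, hS⟩ := Set.exists_subset_card_eq (hk.trans_eq (Set.ncard_univ K).symm)
  refine ⟨fun s u => decide ((e s).1 * x u + (e s).2 ∈ S), fun u => ?_, fun u w huw => ?_⟩
  · rw [← hS, ← ncard_affine_mem (x u)]
    simpa using ncard_preimage_equiv e {p | p.1 * x u + p.2 ∈ S}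
  · rw [← hS, ← ncard_affine_mem_and_affine_mem (x.injective.ne huw)]
    simpa using ncard_preimage_equiv e {p | p.1 * x u + p.2 ∈ S ∧ p.1 * x w + p.2 ∈ S}

/-- A single run without sampling and with budget `0`; these parameters only serve when no graph
satisfies the a priori bounds. -/
instance {n : ℕ} : Inhabited (Params n) where
  default :=
    { pV := 1
      pE := 1
      pV_pos := one_pos
      pV_le := le_rfl
      pE_pos := one_pos
      pE_le := le_rfl
      numSeeds := 1
      numSeeds_pos := one_pos
      hV := fun _ _ => true
      hV_marginal := by simp
      hV_pairwise := by simp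
      numMean := 1
      numMean_pos := one_pos
      numGroups := 1
      numGroups_pos := one_pos
      budget := 0 }

theorem exists_params {n a k numMean numGroups : ℕ} {pE : ℝ} (ha : a ≠ 0) (hn : n ≤ 2 ^ a)
    (hk : 0 < k) (hk' : k ≤ 2 ^ a) (hpE : 0 < pE) (hpE' : pE ≤ 1) (hN : 0 < numMean)
    (hM : 0 < numGroups) (budget : ℕ) :
    ∃ θ : Params n, θ.pV = k / 2 ^ a ∧ θ.pE = pE ∧ θ.numSeeds = 2 ^ a * 2 ^ a ∧
      θ.numMean = numMean ∧ θ.numGroups = numGroups ∧ θ.budget = budget := by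
  have hcard : Nat.card (GaloisField 2 a) = 2 ^ a := GaloisField.card 2 a ha
  obtain ⟨hV, hmarginal, hpairwise⟩ :=
    hcard ▸ exists_pairwiseIndependent (GaloisField 2 a) (hn.trans_eq hcard.symm)
      (hk'.trans_eq hcard.symm)
  exact
    ⟨{ pV := k / 2 ^ a
       pE := pE
       pV_pos := by positivity
       pV_le := div_le_one_of_le₀ (by exact_mod_cast hk') (by positivity)
       pE_pos := hpE
       pE_le := hpE'
       numSeeds := 2 ^ a * 2 ^ a
       numSeeds_pos := by positivity
       hV := hV
       hV_marginal := fun u => by rw [hmarginal]; push_cast; field_simp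
       hV_pairwise := fun u w huw => by rw [hpairwise u w huw]; push_cast; field_simp
       numMean := numMean
       numMean_pos := hN
       numGroups := numGroups
       numGroups_pos := hM
       budget := budget }, rfl, rfl, rfl, rfl, rfl, rfl⟩

end PairwiseIndependence

section RunLaw

variable {n : ℕ} (θ : Params n) {κ : Type*}

/-- The law of the random choices of one run: the index of its hash function `h_V`, and one bit
`h_E` for each of the arrivals, which are indexed by `κ`. -/
noncomputable def runLaw (κ : Type*) [Fintype κ] : Measure (Fin θ.numSeeds × (κ → Bool)) :=
  (uniformOn Set.univ).prod (Measure.pi fun _ => bernoulliLaw θ.pE)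

/-- The event that the vertex `u` and all the arrivals in `A` are sampled. -/
def sampled (u : Fin n) (A : Finset κ) : Set (Fin θ.numSeeds × (κ → Bool)) :=
  {ω | θ.hV ω.1 u = true ∧ ∀ a ∈ A, ω.2 a = true}

instance : NeZero θ.numSeeds := ⟨θ.numSeeds_pos.ne'⟩

instance : IsProbabilityMeasure (bernoulliLaw θ.pE) where
  measure_univ := by
    simp [bernoulliLaw, ← ENNReal.ofReal_add θ.pE_pos.le (sub_nonneg.2 θ.pE_le)]

variable [Fintype κ]

instance : IsProbabilityMeasure (runLaw θ κ) := by
  unfold runLaw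
  infer_instance

theorem uniformOn_univ_real {α : Type*} [Finite α] [MeasurableSpace α]
    [MeasurableSingletonClass α] (S : Set α) :
    (uniformOn Set.univ).real S = S.ncard / Nat.card α := by
  have := Fintype.ofFinite α
  rw [Measure.real, uniformOn_univ, Measure.count_apply S.toFinite.measurableSet,
    ← S.toFinite.cast_ncard_eq, ENat.toENNReal_coe]
  simp

theorem runLaw_real_hash_and_bits (S : Set (Fin θ.numSeeds)) (A : Finset κ) :
    (runLaw θ κ).real {ω | ω.1 ∈ S ∧ ∀ a ∈ A, ω.2 a = true} =
      S.ncard / θ.numSeeds * θ.pE ^ A.card := by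
  classical
  have hprod : {ω : Fin θ.numSeeds × (κ → Bool) | ω.1 ∈ S ∧ ∀ a ∈ A, ω.2 a = true} =
      S ×ˢ (Set.univ.pi fun a => if a ∈ A then {true} else Set.univ) := by
    ext ω
    simp only [Set.mem_ofPred_eq, Set.mem_prod, Set.mem_univ_pi, Set.mem_ite_univ_right,
      Set.mem_singleton_iff]
  have hbit : (bernoulliLaw θ.pE).real {true} = θ.pE := by
    simp [Measure.real, bernoulliLaw, θ.pE_pos.le]
  rw [hprod, runLaw, measureReal_prod_prod, uniformOn_univ_real, Nat.card_fin, Measure.real,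
    Measure.pi_pi, ENNReal.toReal_prod]
  simp only [← Measure.real_def, apply_ite (bernoulliLaw θ.pE).real, hbit, probReal_univ,
    Finset.prod_ite_mem, Finset.univ_inter, Finset.prod_const]

theorem runLaw_real_sampled (u : Fin n) (A : Finset κ) :
    (runLaw θ κ).real (sampled θ u A) = θ.pV * θ.pE ^ A.card := by
  have := runLaw_real_hash_and_bits θ {k | θ.hV k u = true} A
  rwa [θ.hV_marginal, mul_div_cancel_right₀ _ (NeZero.ne _)] at this

theorem runLaw_real_sampled_inter [DecidableEq κ] (u w : Fin n) (A B : Finset κ) :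
    (runLaw θ κ).real (sampled θ u A ∩ sampled θ w B) =
      (if u = w then θ.pV else θ.pV ^ 2) * θ.pE ^ (A ∪ B).card := by
  have hinter : sampled θ u A ∩ sampled θ w B =
      {ω | ω.1 ∈ {k | θ.hV k u = true ∧ θ.hV k w = true} ∧ ∀ a ∈ A ∪ B, ω.2 a = true} := by
    ext ω
    simp only [sampled, Set.mem_inter_iff, Set.mem_ofPred_eq, Finset.forall_mem_union]
    tauto
  rw [hinter, runLaw_real_hash_and_bits]
  congr 1
  split_ifs with huw
  · simp only [huw, and_self]
    rw [θ.hV_marginal, mul_div_cancel_right₀ _ (NeZero.ne _)]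
  · rw [θ.hV_pairwise u w huw, mul_div_cancel_right₀ _ (NeZero.ne _)]

end RunLaw

section SampledCount

variable {n : ℕ} (θ : Params n) {κ ι : Type*}

/-- The number of the configurations in `W` that are sampled, where the configuration `τ` consists
of the vertex `u τ` and the arrivals in `A τ`. -/
noncomputable def sampledCount (W : Finset ι) (u : ι → Fin n) (A : ι → Finset κ)
    (ω : Fin θ.numSeeds × (κ → Bool)) : ℝ :=
  ∑ τ ∈ W, (sampled θ (u τ) (A τ)).indicator 1 ω

theorem sum_card_inter_le [DecidableEq κ] {W : Finset ι} {A : ι → Finset κ} {d : ℕ}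
    (h : ∀ a, (W.filter fun τ => a ∈ A τ).card ≤ d) (B : Finset κ) :
    ∑ τ ∈ W, (B ∩ A τ).card ≤ B.card * d := by
  calc _ = ∑ a ∈ B, (W.filter fun τ => a ∈ A τ).card := by
        simp only [← Finset.filter_mem_eq_inter]
        exact (Finset.sum_card_bipartiteAbove_eq_sum_card_bipartiteBelow _).symm
    _ ≤ B.card * d := Finset.sum_le_card_nsmul _ _ _ fun a _ => h a

variable [Fintype κ]

theorem integral_sampledCount (W : Finset ι) (u : ι → Fin n) (A : ι → Finset κ) :
    ∫ ω, sampledCount θ W u A ω ∂runLaw θ κ = ∑ τ ∈ W, θ.pV * θ.pE ^ (A τ).card := by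
  unfold sampledCount
  rw [integral_finsetSum _ fun τ _ => Integrable.of_finite]
  refine Finset.sum_congr rfl fun τ _ => ?_
  rw [integral_indicator_one (Set.toFinite _).measurableSet, runLaw_real_sampled]

variable [DecidableEq κ]

theorem covariance_sampled (u w : Fin n) (A B : Finset κ) :
    cov[(sampled θ u A).indicator 1, (sampled θ w B).indicator 1; runLaw θ κ] =
      (if u = w then θ.pV else θ.pV ^ 2) * θ.pE ^ (A ∪ B).card -
        (θ.pV * θ.pE ^ A.card) * (θ.pV * θ.pE ^ B.card) := by
  have hmeas (S : Set (Fin θ.numSeeds × (κ → Bool))) : MeasurableSet S := S.toFinite.measurableSet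
  rw [covariance_eq_sub .of_discrete .of_discrete, ← Set.inter_indicator_one,
    integral_indicator_one (hmeas _), integral_indicator_one (hmeas _),
    integral_indicator_one (hmeas _), runLaw_real_sampled_inter, runLaw_real_sampled,
    runLaw_real_sampled]

theorem covariance_sampled_le (u w : Fin n) {A B : Finset κ} (hA : A.card = 2) (hB : B.card = 2) :
    cov[(sampled θ u A).indicator 1, (sampled θ w B).indicator 1; runLaw θ κ] ≤
      (if u = w then θ.pV * θ.pE ^ 4 else 0) + (A ∩ B).card * (θ.pV * θ.pE ^ 3) +
        (if A = B then θ.pV * θ.pE ^ 2 else 0) := by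
  have hV := θ.pV_pos
  have hE := θ.pE_pos
  have hfactor : (if u = w then θ.pV else θ.pV ^ 2) ≤ θ.pV := by
    split_ifs
    exacts [le_rfl, pow_le_of_le_one hV.le θ.pV_le two_ne_zero]
  have hinter : (A ∩ B).card ≤ 2 := hA ▸ Finset.card_le_card Finset.inter_subset_left
  have hunion : (A ∪ B).card + (A ∩ B).card = 4 := by
    rw [Finset.card_union_add_card_inter, hA, hB]
  have hproduct : (if u = w then θ.pV else θ.pV ^ 2) * θ.pE ^ (A ∪ B).card ≤
      θ.pV * θ.pE ^ (A ∪ B).card := by gcongr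
  have hsq : 0 ≤ θ.pV * θ.pE ^ 2 * (θ.pV * θ.pE ^ 2) := by positivity
  have hapex : 0 ≤ if u = w then θ.pV * θ.pE ^ 4 else 0 := by split_ifs <;> positivity
  have hcommon : 0 ≤ (A ∩ B).card * (θ.pV * θ.pE ^ 3) := by positivity
  have hsame : 0 ≤ if A = B then θ.pV * θ.pE ^ 2 else 0 := by split_ifs <;> positivity
  rw [covariance_sampled, hA, hB]
  obtain hdisj | hone | htwo : (A ∩ B).card = 0 ∨ (A ∩ B).card = 1 ∨ (A ∩ B).card = 2 := by omega
  · rw [show (A ∪ B).card = 4 by omega]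
    split_ifs at hsame ⊢ <;> linarith
  · rw [show (A ∪ B).card = 3 by omega] at hproduct ⊢
    rw [hone, Nat.cast_one]
    linarith
  · have hAB : A = B :=
      (Finset.eq_of_subset_of_card_le Finset.inter_subset_left (by omega)).symm.trans
        (Finset.eq_of_subset_of_card_le Finset.inter_subset_right (by omega))
    rw [show (A ∪ B).card = 2 by omega] at hproduct ⊢
    rw [if_pos hAB]
    linarith

theorem variance_sampledCount_le {W : Finset ι} {u : ι → Fin n} {A : ι → Finset κ}
    (hA : ∀ τ ∈ W, (A τ).card = 2) (hinj : Set.InjOn A W) {d₁ d₂ : ℕ}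
    (h₁ : ∀ x, (W.filter fun τ => u τ = x).card ≤ d₁)
    (h₂ : ∀ a, (W.filter fun τ => a ∈ A τ).card ≤ d₂) :
    Var[sampledCount θ W u A; runLaw θ κ] ≤
      W.card * (d₁ * (θ.pV * θ.pE ^ 4) + 2 * d₂ * (θ.pV * θ.pE ^ 3) + θ.pV * θ.pE ^ 2) := by
  have hV := θ.pV_pos
  have hE := θ.pE_pos
  unfold sampledCount
  rw [variance_fun_sum' fun τ _ => .of_discrete, ← nsmul_eq_mul]
  refine Finset.sum_le_card_nsmul _ _ _ fun τ hτ => ?_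
  have hapex : ((W.filter fun τ' => u τ = u τ').card : ℝ) ≤ d₁ := by
    simpa only [eq_comm] using Nat.cast_le.2 (h₁ (u τ))
  have hcommon : (∑ τ' ∈ W, (A τ ∩ A τ').card : ℝ) ≤ 2 * d₂ := by
    have := sum_card_inter_le h₂ (A τ)
    rw [hA τ hτ] at this
    exact_mod_cast this
  have hsame : ((W.filter fun τ' => A τ = A τ').card : ℝ) ≤ 1 := by
    norm_cast
    refine Finset.card_le_one.2 fun σ hσ σ' hσ' => ?_
    rw [Finset.mem_filter] at hσ hσ'
    exact hinj hσ.1 hσ'.1 (hσ.2.symm.trans hσ'.2)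
  calc _ ≤ ∑ τ' ∈ W, ((if u τ = u τ' then θ.pV * θ.pE ^ 4 else 0) +
          (A τ ∩ A τ').card * (θ.pV * θ.pE ^ 3) +
            (if A τ = A τ' then θ.pV * θ.pE ^ 2 else 0)) :=
        Finset.sum_le_sum fun τ' hτ' => covariance_sampled_le θ _ _ (hA τ hτ) (hA τ' hτ')
    _ = (W.filter fun τ' => u τ = u τ').card * (θ.pV * θ.pE ^ 4) +
          (∑ τ' ∈ W, (A τ ∩ A τ').card : ℝ) * (θ.pV * θ.pE ^ 3) +
            (W.filter fun τ' => A τ = A τ').card * (θ.pV * θ.pE ^ 2) := by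
        simp only [Finset.sum_add_distrib, ← Finset.sum_filter, Finset.sum_const, nsmul_eq_mul,
          Finset.sum_mul]
    _ ≤ d₁ * (θ.pV * θ.pE ^ 4) + 2 * d₂ * (θ.pV * θ.pE ^ 3) + 1 * (θ.pV * θ.pE ^ 2) := by gcongr
    _ = _ := by rw [one_mul]

end SampledCount

section RunState

variable {n : ℕ} (θ : Params n) (l : List (SignedEdge n))

/-- The memory of a single run after the first `t` arrivals of the stream `l`, where `ω` consists
of the index of `h_V` and of the bits `h_E` of all arrivals. -/
noncomputable def runState (ω : Fin θ.numSeeds × (Fin l.length → Bool)) (t : ℕ) : EstMem θ :=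
  ((List.finRange l.length).take t).foldl (fun M i => estStep M (l.get i) (ω.2 i)) (estInit θ ω.1)

variable {θ l} (ω : Fin θ.numSeeds × (Fin l.length → Bool))

theorem take_succ_finRange {L : ℕ} (i : Fin L) :
    (List.finRange L).take (i + 1) = (List.finRange L).take i ++ [i] := by
  rw [List.take_succ_eq_append_getElem (by simp)]
  simp

theorem runState_zero : runState θ l ω 0 = estInit θ ω.1 := rfl

theorem runState_succ (i : Fin l.length) :
    runState θ l ω (i + 1) = estStep (runState θ l ω i) (l.get i) (ω.2 i) := by
  simp [runState, take_succ_finRange]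

@[elab_as_elim]
theorem arrival_induction {L : ℕ} {motive : ℕ → Prop} (zero : motive 0)
    (succ : ∀ i : Fin L, motive i → motive (i + 1)) (t : ℕ) (ht : t ≤ L) : motive t := by
  induction t with
  | zero => exact zero
  | succ t ih => exact succ ⟨t, ht⟩ (ih (Nat.le_of_succ_le ht))

theorem runState_seed (t : ℕ) : (runState θ l ω t).seed = ω.1 := by
  unfold runState
  induction (List.finRange l.length).take t using List.reverseRecOn with
  | nil => rfl
  | append_singleton is i ih => rw [List.foldl_concat]; exact ih

theorem numStored_estInit (k : Fin θ.numSeeds) : (estInit θ k).numStored = 0 := by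
  simp [EstMem.numStored, estInit]

theorem numStored_le_numStored_estStep (M : EstMem θ) (a : SignedEdge n) (b : Bool) :
    M.numStored ≤ (estStep M a b).numStored := by
  refine Set.ncard_le_ncard (fun e he => ?_) (Set.toFinite _)
  simp only [estStep, Set.mem_ofPred_eq] at he ⊢
  split_ifs
  · rw [Function.update_apply]
    split_ifs
    exacts [Option.some_ne_none _, he]
  · exact he

theorem eq_of_edge_eq (hl : (l.map SignedEdge.edge).Nodup) {a b : Fin l.length}
    (hab : (l.get a).edge = (l.get b).edge) : a = b :=
  Fin.ext <| (hl.getElem_inj_iff (hi := by simp) (hj := by simp)).1 (by simpa using hab)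

theorem exists_val_lt_succ_iff {L : ℕ} (i : Fin L) (P : Fin L → Prop) :
    (∃ a : Fin L, a.val < i + 1 ∧ P a) ↔ (∃ a : Fin L, a.val < i ∧ P a) ∨ P i := by
  simp only [Nat.lt_succ_iff_lt_or_eq, Fin.val_inj, or_and_right, exists_or, exists_eq_left]

theorem runState_S_eq_some (hl : (l.map SignedEdge.edge).Nodup) {t : ℕ} (ht : t ≤ l.length)
    (e : Sym2 (Fin n)) (x : ℤˣ) :
    (runState θ l ω t).S e = some x ↔ ∃ a : Fin l.length, a.val < t ∧ (l.get a).edge = e ∧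
      ω.2 a = true ∧ (θ.hV ω.1 (l.get a).v = true ∨ θ.hV ω.1 (l.get a).w = true) ∧
        (l.get a).sign = x := by
  refine arrival_induction ?_ (fun i ih => ?_) t ht
  · simp [runState_zero, estInit]
  · rw [exists_val_lt_succ_iff, ← ih, runState_succ, estStep, runState_seed]
    by_cases he : (l.get i).edge = e
    · have hnew : (runState θ l ω i).S e ≠ some x := by
        rw [Ne, ih]
        rintro ⟨a, hai, hae, -⟩
        exact hai.ne (congrArg Fin.val (eq_of_edge_eq hl (hae.trans he.symm)))
      split_ifs with hstore
      · simp only [he, Function.update_self, Option.some.injEq, hnew, false_or, true_and, hstore]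
      · simp only [he, hnew, true_and, ← and_assoc, hstore, false_and, or_self]
    · split_ifs
      · simp only [Function.update_of_ne (Ne.symm he), he, false_and, or_false]
      · simp only [he, false_and, or_false]

theorem numStored_runState_le (hl : (l.map SignedEdge.edge).Nodup) :
    (runState θ l ω l.length).numStored ≤ (Finset.univ.filter fun i => ω.2 i = true ∧
      (θ.hV ω.1 (l.get i).v = true ∨ θ.hV ω.1 (l.get i).w = true)).card := by
  rw [← Set.ncard_coe_finset]
  refine (Set.ncard_le_ncard (t := (fun i => (l.get i).edge) '' _) (fun e he => ?_)
    (Set.toFinite _)).trans (Set.ncard_image_le (Set.toFinite _))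
  obtain ⟨x, hx⟩ := Option.ne_none_iff_exists'.1 he
  obtain ⟨a, -, hae, hbit, hhash, -⟩ := (runState_S_eq_some ω hl le_rfl e x).1 hx
  exact ⟨a, by simpa using ⟨hbit, hhash⟩, hae⟩

theorem runState_R_eq_sum :
    (runState θ l ω l.length).R =
      (∑ i : Fin l.length, (detected (runState θ l ω i) (l.get i)).ncard : ℝ) *
        (1 / (θ.pV * θ.pE ^ 2)) := by
  suffices h : ∀ t ≤ l.length, (runState θ l ω t).R = (((List.finRange l.length).take t).map
      fun i : Fin l.length => ((detected (runState θ l ω i) (l.get i)).ncard : ℝ)).sum *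
        (1 / (θ.pV * θ.pE ^ 2)) by
    rw [h _ le_rfl, List.take_of_length_le (by simp), Fin.sum_univ_def]
  intro t ht
  refine arrival_induction ?_ (fun i ih => ?_) t ht
  · simp [runState_zero, estInit]
  · rw [runState_succ, take_succ_finRange, List.map_append, List.sum_append, add_mul, ← ih]
    simp [estStep]

end RunState

section Closings

variable {n : ℕ} {l : List (SignedEdge n)}

/-- A triangle whose edges have the signs `z`, `x`, `y` has exactly one positive edge; the formula
is the test made by the estimator when the edge with sign `z` arrives last. -/
def OnePositive (z x y : ℤˣ) : Prop := (z = 1 ∧ x = -1 ∧ y = -1) ∨ (z = -1 ∧ x ≠ y)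

open Classical in
/-- The pairs `(i, u)` such that the `i`-th arrival `vw` completes a triangle with exactly one
positive edge, of which `u` is the third vertex. -/
noncomputable def closings (l : List (SignedEdge n)) : Finset (Fin l.length × Fin n) :=
  Finset.univ.filter fun τ => ∃ a < τ.1, ∃ b < τ.1,
    (l.get a).edge = s(τ.2, (l.get τ.1).v) ∧ (l.get b).edge = s(τ.2, (l.get τ.1).w) ∧
      OnePositive (l.get τ.1).sign (l.get a).sign (l.get b).sign

/-- The arrivals of the two edges `uv` and `uw`, where `τ = (i, u)` and the `i`-th arrival
is `vw`. -/
def legs (l : List (SignedEdge n)) (τ : Fin l.length × Fin n) : Finset (Fin l.length) :=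
  Finset.univ.filter fun a =>
    (l.get a).edge = s(τ.2, (l.get τ.1).v) ∨ (l.get a).edge = s(τ.2, (l.get τ.1).w)

theorem mem_closings {τ : Fin l.length × Fin n} :
    τ ∈ closings l ↔ ∃ a < τ.1, ∃ b < τ.1,
      (l.get a).edge = s(τ.2, (l.get τ.1).v) ∧ (l.get b).edge = s(τ.2, (l.get τ.1).w) ∧
        OnePositive (l.get τ.1).sign (l.get a).sign (l.get b).sign := by
  simp [closings]

theorem mem_legs {τ : Fin l.length × Fin n} {a : Fin l.length} :
    a ∈ legs l τ ↔
      (l.get a).edge = s(τ.2, (l.get τ.1).v) ∨ (l.get a).edge = s(τ.2, (l.get τ.1).w) := by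
  simp [legs]

theorem hash_endpoint_of_edge_eq {θ : Params n} {k : Fin θ.numSeeds} {a : SignedEdge n}
    {u z : Fin n} (hu : θ.hV k u = true) (ha : a.edge = s(u, z)) :
    θ.hV k a.v = true ∨ θ.hV k a.w = true := by
  rcases Sym2.eq_iff.1 ha with ⟨rfl, -⟩ | ⟨-, rfl⟩
  exacts [.inl hu, .inr hu]

variable {θ : Params n} (hl : (l.map SignedEdge.edge).Nodup)
  (ω : Fin θ.numSeeds × (Fin l.length → Bool))
include hl

theorem mem_detected_runState (i : Fin l.length) (u : Fin n) :
    u ∈ detected (runState θ l ω i) (l.get i) ↔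
      (i, u) ∈ closings l ∧ ω ∈ sampled θ u (legs l (i, u)) := by
  simp only [detected, Set.mem_ofPred_eq, runState_seed, runState_S_eq_some ω hl i.is_lt.le,
    mem_closings, sampled, mem_legs]
  constructor
  · rintro ⟨hu, _, _, ⟨a, ha, hae, hac, -, rfl⟩, ⟨b, hb, hbe, hbc, -, rfl⟩, hsign⟩
    refine ⟨⟨a, ha, b, hb, hae, hbe, hsign⟩, hu, fun a' ha' => ?_⟩
    rcases ha' with h | h
    · rwa [eq_of_edge_eq hl (h.trans hae.symm)]
    · rwa [eq_of_edge_eq hl (h.trans hbe.symm)]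
  · rintro ⟨⟨a, ha, b, hb, hae, hbe, hsign⟩, hu, hbits⟩
    exact ⟨hu, _, _,
      ⟨a, ha, hae, hbits a (.inl hae), hash_endpoint_of_edge_eq hu hae, rfl⟩,
      ⟨b, hb, hbe, hbits b (.inr hbe), hash_endpoint_of_edge_eq hu hbe, rfl⟩, hsign⟩

theorem runState_R_eq_sampledCount :
    (runState θ l ω l.length).R =
      sampledCount θ (closings l) Prod.snd (legs l) ω * (1 / (θ.pV * θ.pE ^ 2)) := by
  classical
  have hcount (i : Fin l.length) : ((detected (runState θ l ω i) (l.get i)).ncard : ℝ) =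
      ∑ u, if (i, u) ∈ closings l ∧ ω ∈ sampled θ u (legs l (i, u)) then 1 else 0 := by
    rw [Finset.sum_boole, ← Set.ncard_coe_finset]
    simp [← mem_detected_runState hl]
  have hsum : sampledCount θ (closings l) Prod.snd (legs l) ω =
      ∑ τ, if τ ∈ closings l ∧ ω ∈ sampled θ τ.2 (legs l τ) then 1 else 0 := by
    simp only [sampledCount, Set.indicator_apply, Pi.one_apply, ite_and, Finset.sum_ite_mem,
      Finset.univ_inter]
  rw [runState_R_eq_sum, hsum, Fintype.sum_prod_type, Finset.sum_congr rfl fun i _ => hcount i]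

end Closings

section Triangles

variable {V : Type*} [DecidableEq V]

theorem mem_edgeSet_and_subset_triple_iff {H : SimpleGraph V} {u v w : V} (huv : H.Adj u v)
    (huw : H.Adj u w) (hvw : H.Adj v w) (e : Sym2 V) :
    (e ∈ H.edgeSet ∧ ∀ x ∈ e, x ∈ ({u, v, w} : Finset V)) ↔
      e = s(u, v) ∨ e = s(u, w) ∨ e = s(v, w) := by
  constructor
  · induction e with | _ x y
    simp only [SimpleGraph.mem_edgeSet, Sym2.mem_iff, forall_eq_or_imp, forall_eq,
      Finset.mem_insert, Finset.mem_singleton]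
    rintro ⟨hadj, rfl | rfl | rfl, rfl | rfl | rfl⟩ <;> simp_all [Sym2.eq_swap]
  · rintro (rfl | rfl | rfl) <;> simp_all

theorem exists_eq_triple_of_card_eq_three {t : Finset V} (ht : t.card = 3) {v w : V} (hv : v ∈ t)
    (hw : w ∈ t) (hvw : v ≠ w) : ∃ u, u ≠ v ∧ u ≠ w ∧ t = {u, v, w} := by
  have hcard : ((t.erase v).erase w).card = 1 := by
    rw [Finset.card_erase_of_mem (Finset.mem_erase.2 ⟨hvw.symm, hw⟩), Finset.card_erase_of_mem hv,
      ht]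
  obtain ⟨u, hu⟩ := Finset.card_eq_one.1 hcard
  have hmem : u ∈ (t.erase v).erase w := hu ▸ Finset.mem_singleton_self u
  simp only [Finset.mem_erase] at hmem
  refine ⟨u, hmem.2.1, hmem.1, ?_⟩
  rw [← Finset.insert_erase hv, ← Finset.insert_erase (Finset.mem_erase.2 ⟨hvw.symm, hw⟩), hu,
    Finset.pair_comm, Finset.insert_comm]

variable {n : ℕ} (G : SignedGraph n)

theorem onePositive_iff_ncard_positiveEdgesIn {u v w : Fin n} (huv : G.graph.Adj u v)
    (huw : G.graph.Adj u w) (hvw : G.graph.Adj v w) :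
    OnePositive (G.sign s(v, w)) (G.sign s(u, v)) (G.sign s(u, w)) ↔
      (G.positiveEdgesIn {u, v, w}).ncard = 1 := by
  have hset : G.positiveEdgesIn {u, v, w} = (({s(u, v), s(u, w), s(v, w)} : Finset _).filter
      fun e => G.sign e = 1 : Finset (Sym2 (Fin n))) := by
    ext e
    rw [SignedGraph.positiveEdgesIn, Set.mem_ofPred_eq, ← and_assoc,
      mem_edgeSet_and_subset_triple_iff huv huw hvw]
    simp only [Finset.coe_filter, Finset.mem_insert, Finset.mem_singleton, Set.mem_ofPred_eq]
  have hne₁ : s(u, w) ≠ s(v, w) := by simp [huv.ne, huw.ne]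
  have hne₂ : s(u, v) ∉ ({s(u, w), s(v, w)} : Finset _) := by simp [hvw.ne, huv.ne, huw.ne]
  rw [hset, Set.ncard_coe_finset, Finset.card_filter, Finset.sum_insert hne₂,
    Finset.sum_pair hne₁, OnePositive]
  rcases Int.units_eq_one_or (G.sign s(v, w)) with hz | hz <;>
    rcases Int.units_eq_one_or (G.sign s(u, v)) with hx | hx <;>
    rcases Int.units_eq_one_or (G.sign s(u, w)) with hy | hy <;> rw [hx, hy, hz] <;> decide

theorem ncard_triangles_edge_le {e : Sym2 (Fin n)} (he : e ∈ G.graph.edgeSet) :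
    {t | t ∈ G.triangles ∧ ∀ x ∈ e, x ∈ t}.ncard ≤ G.maxTrianglesAtEdge :=
  le_ciSup (f := fun e : G.graph.edgeSet =>
    {t | t ∈ G.triangles ∧ ∀ x ∈ (e : Sym2 (Fin n)), x ∈ t}.ncard)
    (Set.finite_range _).bddAbove ⟨e, he⟩

theorem ncard_triangles_vertex_le (v : Fin n) :
    {t | t ∈ G.triangles ∧ v ∈ t}.ncard ≤ G.maxTrianglesAtVertex :=
  le_ciSup (f := fun v : Fin n => {t | t ∈ G.triangles ∧ v ∈ t}.ncard)
    (Set.finite_range _).bddAbove v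

theorem SignedGraph.exists_isStreamOf : ∃ l : List (SignedEdge n), IsStreamOf l G := by
  classical
  let f (e : Sym2 (Fin n)) : SignedEdge n := ⟨e.out.1, e.out.2, G.sign e⟩
  have hf (e) : (f e).edge = e := Quot.out_eq e
  have hmap : (G.graph.edgeFinset.toList.map f).map SignedEdge.edge =
      G.graph.edgeFinset.toList := by
    simp only [List.map_map, Function.comp_def, hf, List.map_id']
  refine ⟨G.graph.edgeFinset.toList.map f, ?_, fun e => ?_, fun a ha => ?_⟩
  · rw [hmap]
    exact Finset.nodup_toList _
  · simp only [hmap, Finset.mem_toList, SimpleGraph.mem_edgeFinset]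
  · obtain ⟨e, -, rfl⟩ := List.mem_map.1 ha
    rw [hf]

end Triangles

section Stream

variable {n : ℕ} {l : List (SignedEdge n)} {G : SignedGraph n}

/-- The vertex set of the triangle `uvw`, where `τ = (i, u)` and the `i`-th arrival is `vw`. -/
def closedTriangle (l : List (SignedEdge n)) (τ : Fin l.length × Fin n) : Finset (Fin n) :=
  {τ.2, (l.get τ.1).v, (l.get τ.1).w}

theorem apex_mem_closedTriangle (τ : Fin l.length × Fin n) : τ.2 ∈ closedTriangle l τ :=
  Finset.mem_insert_self _ _

theorem edge_subset_closedTriangle {τ : Fin l.length × Fin n} :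
    ∀ x ∈ (l.get τ.1).edge, x ∈ closedTriangle l τ := by
  simp [SignedEdge.edge, closedTriangle]

theorem edge_subset_closedTriangle_of_mem_legs {τ : Fin l.length × Fin n} {a : Fin l.length}
    (ha : a ∈ legs l τ) : ∀ x ∈ (l.get a).edge, x ∈ closedTriangle l τ := by
  rcases mem_legs.1 ha with h | h <;> rw [h] <;> simp [closedTriangle]

theorem exists_mem_legs_iff_mem_closedTriangle {τ : Fin l.length × Fin n} (hτ : τ ∈ closings l)
    (x : Fin n) : (∃ a ∈ legs l τ, x ∈ (l.get a).edge) ↔ x ∈ closedTriangle l τ := by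
  refine ⟨fun ⟨a, ha, hx⟩ => edge_subset_closedTriangle_of_mem_legs ha x hx, fun hx => ?_⟩
  obtain ⟨a, -, b, -, ha, hb, -⟩ := mem_closings.1 hτ
  simp only [closedTriangle, Finset.mem_insert, Finset.mem_singleton] at hx
  rcases hx with rfl | rfl | rfl
  · exact ⟨a, mem_legs.2 (.inl ha), ha ▸ Sym2.mem_mk_left _ _⟩
  · exact ⟨a, mem_legs.2 (.inl ha), ha ▸ Sym2.mem_mk_right _ _⟩
  · exact ⟨b, mem_legs.2 (.inr hb), hb ▸ Sym2.mem_mk_right _ _⟩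

namespace IsStreamOf

variable (hl : IsStreamOf l G)
include hl

theorem edge_mem (i : Fin l.length) : (l.get i).edge ∈ G.graph.edgeSet :=
  (hl.2.1 _).1 (List.mem_map_of_mem (List.get_mem l i))

theorem adj {i : Fin l.length} {x y : Fin n} (h : (l.get i).edge = s(x, y)) : G.graph.Adj x y :=
  (SimpleGraph.mem_edgeSet G.graph).1 (h ▸ hl.edge_mem i)

theorem exists_arrival {x y : Fin n} (h : G.graph.Adj x y) :
    ∃ i : Fin l.length, (l.get i).edge = s(x, y) := by
  obtain ⟨a, ha, hae⟩ := List.mem_map.1 ((hl.2.1 s(x, y)).2 h)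
  obtain ⟨i, rfl⟩ := List.get_of_mem ha
  exact ⟨i, hae⟩

theorem sign_eq {i : Fin l.length} {e : Sym2 (Fin n)} (h : (l.get i).edge = e) :
    (l.get i).sign = G.sign e := by
  rw [hl.2.2 _ (List.get_mem l i), h]

theorem length_eq : l.length = G.numEdges := by
  have hset : G.graph.edgeSet = ((l.map SignedEdge.edge).toFinset : Set _) := by
    ext e
    rw [← hl.2.1 e, Finset.mem_coe, List.mem_toFinset]
  rw [SignedGraph.numEdges, hset, Set.ncard_coe_finset, List.toFinset_card_of_nodup hl.1,
    List.length_map]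

theorem adj_of_mem_closings {τ : Fin l.length × Fin n} (hτ : τ ∈ closings l) :
    G.graph.Adj τ.2 (l.get τ.1).v ∧ G.graph.Adj τ.2 (l.get τ.1).w ∧
      G.graph.Adj (l.get τ.1).v (l.get τ.1).w := by
  obtain ⟨a, -, b, -, ha, hb, -⟩ := mem_closings.1 hτ
  exact ⟨hl.adj ha, hl.adj hb, hl.adj (i := τ.1) rfl⟩

theorem closedTriangle_mem {τ : Fin l.length × Fin n} (hτ : τ ∈ closings l) :
    closedTriangle l τ ∈ G.triangles :=
  SimpleGraph.is3Clique_triple_iff.2 (hl.adj_of_mem_closings hτ)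

theorem le_of_edge_subset_closedTriangle {τ : Fin l.length × Fin n} (hτ : τ ∈ closings l)
    {j : Fin l.length} (hj : ∀ x ∈ (l.get j).edge, x ∈ closedTriangle l τ) : j ≤ τ.1 := by
  obtain ⟨huv, huw, hvw⟩ := hl.adj_of_mem_closings hτ
  obtain ⟨a, hai, b, hbi, ha, hb, -⟩ := mem_closings.1 hτ
  rcases (mem_edgeSet_and_subset_triple_iff huv huw hvw _).1 ⟨hl.edge_mem j, hj⟩ with h | h | h
  · exact (eq_of_edge_eq hl.1 (h.trans ha.symm)).trans_le hai.le
  · exact (eq_of_edge_eq hl.1 (h.trans hb.symm)).trans_le hbi.le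
  · exact (eq_of_edge_eq hl.1 h).le

theorem injOn_closedTriangle : Set.InjOn (closedTriangle l) (closings l) := by
  rintro ⟨i, u⟩ hτ ⟨i', u'⟩ hτ' heq
  obtain rfl : i = i' := le_antisymm
    (hl.le_of_edge_subset_closedTriangle hτ' (heq ▸ edge_subset_closedTriangle (τ := (i, u))))
    (hl.le_of_edge_subset_closedTriangle hτ (heq ▸ edge_subset_closedTriangle (τ := (i', u'))))
  obtain ⟨huv, huw, -⟩ := hl.adj_of_mem_closings hτ
  have hu : u ∈ closedTriangle l (i, u') := heq ▸ apex_mem_closedTriangle (i, u)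
  simp only [closedTriangle, Finset.mem_insert, Finset.mem_singleton] at hu
  rw [hu.resolve_right (not_or.2 ⟨huv.ne, huw.ne⟩)]

theorem mem_closings_iff {i : Fin l.length} {u : Fin n} {a b : Fin l.length} (hai : a < i)
    (hbi : b < i) (ha : (l.get a).edge = s(u, (l.get i).v))
    (hb : (l.get b).edge = s(u, (l.get i).w)) :
    (i, u) ∈ closings l ↔ (G.positiveEdgesIn (closedTriangle l (i, u))).ncard = 1 := by
  rw [closedTriangle, ← onePositive_iff_ncard_positiveEdgesIn G (hl.adj ha) (hl.adj hb)
    (hl.adj (i := i) rfl), ← hl.sign_eq ha, ← hl.sign_eq hb,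
    ← hl.sign_eq (i := i) (e := s((l.get i).v, (l.get i).w)) rfl, mem_closings]
  refine ⟨fun ⟨a', _, b', _, ha', hb', h⟩ => ?_, fun h => ⟨a, hai, b, hbi, ha, hb, h⟩⟩
  rwa [eq_of_edge_eq hl.1 (ha.trans ha'.symm), eq_of_edge_eq hl.1 (hb.trans hb'.symm)]

theorem exists_last_arrival {t : Finset (Fin n)} (ht : t ∈ G.triangles) :
    ∃ i u, t = closedTriangle l (i, u) ∧ ∃ a < i, ∃ b < i,
      (l.get a).edge = s(u, (l.get i).v) ∧ (l.get b).edge = s(u, (l.get i).w) := by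
  classical
  have hclique : G.graph.IsNClique 3 t := ht
  have hne : (Finset.univ.filter fun j => ∀ x ∈ (l.get j).edge, x ∈ t).Nonempty := by
    obtain ⟨x, y, z, hxy, -, -, rfl⟩ := SimpleGraph.is3Clique_iff.1 hclique
    obtain ⟨i, hi⟩ := hl.exists_arrival hxy
    exact ⟨i, Finset.mem_filter.2 ⟨Finset.mem_univ _, hi ▸ by simp⟩⟩
  obtain ⟨i, hi, hmax⟩ := Finset.exists_max_image _ id hne
  simp only [Finset.mem_filter, Finset.mem_univ, true_and, id] at hi hmax
  have hv := hi (l.get i).v (Sym2.mem_mk_left _ _)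
  have hw := hi (l.get i).w (Sym2.mem_mk_right _ _)
  obtain ⟨u, huv, huw, htri⟩ :=
    exists_eq_triple_of_card_eq_three hclique.card_eq hv hw (hl.adj (i := i) rfl).ne
  have hu : u ∈ t := htri ▸ Finset.mem_insert_self _ _
  obtain ⟨a, ha⟩ := hl.exists_arrival (hclique.isClique hu hv huv)
  obtain ⟨b, hb⟩ := hl.exists_arrival (hclique.isClique hu hw huw)
  have hlt {j z} (hz : z ∈ t) (hj : (l.get j).edge = s(u, z)) : j < i := by
    refine (hmax j (by simp [-List.get_eq_getElem, hj, hu, hz])).lt_of_ne ?_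
    rintro rfl
    have hmem : u ∈ (l.get j).edge := hj ▸ Sym2.mem_mk_left u z
    exact (Sym2.mem_iff.1 hmem).elim huv huw
  exact ⟨i, u, htri, a, hlt hv ha, b, hlt hw hb, ha, hb⟩

theorem image_closedTriangle : closedTriangle l '' (closings l) =
    {t | t ∈ G.triangles ∧ (G.positiveEdgesIn t).ncard = 1} := by
  ext t
  constructor
  · rintro ⟨τ, hτ, rfl⟩
    obtain ⟨a, hai, b, hbi, ha, hb, -⟩ := mem_closings.1 hτ
    exact ⟨hl.closedTriangle_mem hτ, (hl.mem_closings_iff hai hbi ha hb).1 hτ⟩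
  · rintro ⟨ht, hpos⟩
    obtain ⟨i, u, rfl, a, hai, b, hbi, ha, hb⟩ := hl.exists_last_arrival ht
    exact ⟨(i, u), (hl.mem_closings_iff hai hbi ha hb).2 hpos, rfl⟩

theorem card_closings : (closings l).card = G.numTriangles 1 := by
  rw [SignedGraph.numTriangles, ← hl.image_closedTriangle, hl.injOn_closedTriangle.ncard_image,
    Set.ncard_coe_finset]

theorem card_legs {τ : Fin l.length × Fin n} (hτ : τ ∈ closings l) : (legs l τ).card = 2 := by
  obtain ⟨a, -, b, -, ha, hb, -⟩ := mem_closings.1 hτ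
  refine Finset.card_eq_two.2 ⟨a, b, ?_, ?_⟩
  · rintro rfl
    exact (hl.adj_of_mem_closings hτ).2.2.ne (Sym2.congr_right.1 (ha.symm.trans hb))
  · ext j
    rw [mem_legs, Finset.mem_insert, Finset.mem_singleton, ← ha, ← hb]
    exact or_congr ⟨eq_of_edge_eq hl.1, fun h => h ▸ rfl⟩ ⟨eq_of_edge_eq hl.1, fun h => h ▸ rfl⟩

theorem injOn_legs : Set.InjOn (legs l) (closings l) := by
  intro τ hτ τ' hτ' heq
  refine hl.injOn_closedTriangle hτ hτ' (Finset.ext fun x => ?_)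
  rw [← exists_mem_legs_iff_mem_closedTriangle hτ, heq, exists_mem_legs_iff_mem_closedTriangle hτ']

theorem card_filter_closings_le (p : Fin l.length × Fin n → Prop) [DecidablePred p]
    (q : Finset (Fin n) → Prop) (hpq : ∀ τ, p τ → q (closedTriangle l τ)) :
    ((closings l).filter p).card ≤ {t | t ∈ G.triangles ∧ q t}.ncard := by
  rw [← Set.ncard_coe_finset]
  refine Set.ncard_le_ncard_of_injOn (closedTriangle l) (fun τ hτ => ?_)
    (hl.injOn_closedTriangle.mono fun τ hτ => (Finset.mem_filter.1 hτ).1) (Set.toFinite _)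
  rw [Finset.mem_coe, Finset.mem_filter] at hτ
  exact ⟨hl.closedTriangle_mem hτ.1, hpq τ hτ.2⟩

theorem card_closings_apex_le (x : Fin n) :
    ((closings l).filter fun τ => τ.2 = x).card ≤ min G.maxTrianglesAtVertex G.numEdges := by
  refine le_min ?_ ?_
  · exact (hl.card_filter_closings_le _ _ fun τ hτ => hτ ▸ apex_mem_closedTriangle τ).trans
      (ncard_triangles_vertex_le G x)
  · rw [← hl.length_eq]
    refine (Finset.card_le_card_of_injOn Prod.fst (fun _ _ => Finset.mem_univ _)
      fun τ h τ' h' hfst => Prod.ext hfst ?_).trans (Finset.card_fin _).le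
    exact (Finset.mem_filter.1 h).2.trans (Finset.mem_filter.1 h').2.symm

theorem card_closings_leg_le (a : Fin l.length) :
    ((closings l).filter fun τ => a ∈ legs l τ).card ≤ G.maxTrianglesAtEdge :=
  (hl.card_filter_closings_le _ _ fun _ => edge_subset_closedTriangle_of_mem_legs).trans
    (ncard_triangles_edge_le G (hl.edge_mem a))

theorem numTriangles_le_numEdges_mul :
    G.numTriangles 1 ≤ G.numEdges * G.maxTrianglesAtEdge := by
  rw [← hl.card_closings, ← hl.length_eq, mul_comm]
  have hfiber (i : Fin l.length) : ((closings l).filter fun τ => τ.1 = i).card ≤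
      G.maxTrianglesAtEdge :=
    (hl.card_filter_closings_le _ _ fun _ hτ => hτ ▸ edge_subset_closedTriangle).trans
      (ncard_triangles_edge_le G (hl.edge_mem i))
  simpa using Finset.card_le_mul_card_image_of_maps_to
    (fun τ _ => Finset.mem_univ τ.1) _ fun i _ => hfiber i

theorem numTriangles_le_mul_min :
    G.numTriangles 1 ≤ n * min G.maxTrianglesAtVertex G.numEdges := by
  rw [← hl.card_closings, mul_comm]
  simpa using Finset.card_le_mul_card_image_of_maps_to
    (fun τ _ => Finset.mem_univ τ.2) _ fun x _ => hl.card_closings_apex_le x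

end IsStreamOf

end Stream

section RunMoments

variable {n : ℕ} (θ : Params n) {l : List (SignedEdge n)}

theorem numStored_runState_le_sampledCount (hl : (l.map SignedEdge.edge).Nodup)
    (ω : Fin θ.numSeeds × (Fin l.length → Bool)) :
    ((runState θ l ω l.length).numStored : ℝ) ≤
      sampledCount θ Finset.univ (fun i => (l.get i).v) singleton ω +
        sampledCount θ Finset.univ (fun i => (l.get i).w) singleton ω := by
  refine (Nat.cast_le.2 (numStored_runState_le ω hl)).trans ?_
  simp only [sampledCount, ← Finset.sum_add_distrib, Finset.card_filter, Nat.cast_sum]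
  refine Finset.sum_le_sum fun i _ => ?_
  simp only [Set.indicator_apply, sampled, Set.mem_ofPred_eq, Finset.mem_singleton, forall_eq,
    Pi.one_apply]
  by_cases hbit : ω.2 i = true <;> by_cases hv : θ.hV ω.1 (l.get i).v = true <;>
    by_cases hw : θ.hV ω.1 (l.get i).w = true <;> simp [-List.get_eq_getElem, hbit, hv, hw]

variable {G : SignedGraph n} (hl : IsStreamOf l G)
include hl

theorem integral_numStored_runState_le :
    ∫ ω, ((runState θ l ω l.length).numStored : ℝ) ∂runLaw θ (Fin l.length) ≤
      2 * (G.numEdges * (θ.pV * θ.pE)) := by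
  refine (integral_mono .of_finite .of_finite
    (numStored_runState_le_sampledCount θ hl.1)).trans_eq ?_
  rw [integral_add .of_finite .of_finite, integral_sampledCount, integral_sampledCount]
  simp only [Finset.card_singleton, pow_one, Finset.sum_const, Finset.card_univ,
    Fintype.card_fin, nsmul_eq_mul, hl.length_eq]
  ring

theorem integral_R_runState :
    ∫ ω, (runState θ l ω l.length).R ∂runLaw θ (Fin l.length) = G.numTriangles 1 := by
  have hV := θ.pV_pos
  have hE := θ.pE_pos
  simp only [runState_R_eq_sampledCount hl.1]
  rw [integral_mul_const, integral_sampledCount,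
    Finset.sum_congr rfl fun τ hτ => by rw [hl.card_legs hτ], Finset.sum_const, hl.card_closings,
    nsmul_eq_mul]
  field_simp

theorem variance_R_runState_le :
    Var[fun ω => (runState θ l ω l.length).R; runLaw θ (Fin l.length)] ≤
      G.numTriangles 1 * (min G.maxTrianglesAtVertex G.numEdges / θ.pV +
        2 * G.maxTrianglesAtEdge / (θ.pV * θ.pE) + 1 / (θ.pV * θ.pE ^ 2)) := by
  have hV := θ.pV_pos
  have hE := θ.pE_pos
  simp only [runState_R_eq_sampledCount hl.1]
  rw [variance_mul_const]
  have hcount := variance_sampledCount_le θ (fun τ hτ => hl.card_legs hτ) hl.injOn_legs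
    hl.card_closings_apex_le hl.card_closings_leg_le
  rw [hl.card_closings] at hcount
  refine (mul_le_mul_of_nonneg_right hcount (sq_nonneg _)).trans_eq ?_
  push_cast
  field_simp

end RunMoments

section GroupState

variable {n : ℕ} (θ : Params n) (l : List (SignedEdge n))

/-- The memory of a group after the first `t` arrivals. As a run never forgets an edge, a group is
abandoned by that time if and only if its runs, had they been continued, store too many edges. -/
noncomputable def groupState (y : Fin θ.numMean → Fin θ.numSeeds × (Fin l.length → Bool)) (t : ℕ) :
    GroupMem θ :=
  if ∑ j, (runState θ l (y j) t).numStored ≤ θ.budget then some fun j => runState θ l (y j) t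
  else none

variable {θ l}

theorem groupState_zero (y : Fin θ.numMean → Fin θ.numSeeds × (Fin l.length → Bool)) :
    groupState θ l y 0 = some fun j => estInit θ (y j).1 := by
  simp [groupState, runState_zero, numStored_estInit]

theorem groupState_succ (y : Fin θ.numMean → Fin θ.numSeeds × (Fin l.length → Bool))
    (i : Fin l.length) :
    groupState θ l y (i + 1) = groupStep (groupState θ l y i) (l.get i) fun j => (y j).2 i := by
  simp only [groupState, runState_succ]
  by_cases hbudget : ∑ j, (runState θ l (y j) i).numStored ≤ θ.budget
  · rw [if_pos hbudget, groupStep]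
  · rw [if_neg hbudget, groupStep, if_neg]
    exact fun h => hbudget
      ((Finset.sum_le_sum fun j _ => numStored_le_numStored_estStep _ _ _).trans h)

theorem medianOfMeans_run (k : Fin θ.numGroups → Fin θ.numMean → Fin θ.numSeeds)
    (c : Fin l.length → Fin θ.numGroups → Fin θ.numMean → Bool) :
    (medianOfMeans θ).run l k c =
      fun g => groupState θ l (fun j => (k g j, fun i => c i g j)) l.length := by
  suffices h : ∀ t ≤ l.length, ((List.finRange l.length).take t).foldl
      (fun M i => (medianOfMeans θ).step M (l.get i) (c i)) ((medianOfMeans θ).init k) =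
        fun g => groupState θ l (fun j => (k g j, fun i => c i g j)) t by
    rw [StreamAlg.run, ← h _ le_rfl, List.take_of_length_le (by simp)]
  intro t ht
  refine arrival_induction ?_ (fun i ih => ?_) t ht
  · simp only [groupState_zero]
    rfl
  · simp only [take_succ_finRange, List.foldl_concat, ih, groupState_succ]
    rfl

theorem outProb_medianOfMeans (E : Set ℝ) :
    (medianOfMeans θ).outProb (seedLaw θ) (coinLaw θ) l E =
      Measure.pi (fun _ : Fin θ.numGroups => Measure.pi fun _ => runLaw θ (Fin l.length))
        {y | (median fun g => groupMean (groupState θ l (y g) l.length)) ∈ E} := by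
  simp only [runLaw]
  rw [← map_pi_prod_pi_eq_pi_prod, Measure.map_apply (by fun_prop) (Set.toFinite _).measurableSet,
    StreamAlg.outProb]
  simp only [medianOfMeans_run]
  rfl

end GroupState

section Accuracy

variable {n : ℕ} (θ : Params n) {l : List (SignedEdge n)} {G : SignedGraph n}
  (hl : IsStreamOf l G)
include hl

theorem measure_budget_lt_le
    (hbudget : 64 * (θ.numMean * (G.numEdges * (θ.pV * θ.pE))) ≤ θ.budget + 1) :
    Measure.pi (fun _ : Fin θ.numMean => runLaw θ (Fin l.length))
      {y | θ.budget < ∑ j, (runState θ l (y j) l.length).numStored} ≤ ENNReal.ofReal (1 / 32) := by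
  have hset : {y : Fin θ.numMean → _ | θ.budget < ∑ j, (runState θ l (y j) l.length).numStored} =
      {y | (θ.budget + 1 : ℝ) ≤ ∑ j, ((runState θ l (y j) l.length).numStored : ℝ)} := by
    ext y
    rw [Set.mem_ofPred_eq, Set.mem_ofPred_eq, ← Nat.succ_le_iff]
    norm_cast
  rw [hset]
  refine (measure_pi_le_sum_le (runLaw θ (Fin l.length))
    (X := fun ω => ((runState θ l ω l.length).numStored : ℝ)) .of_finite
    (fun ω => Nat.cast_nonneg _) (by positivity)).trans (ENNReal.ofReal_le_ofReal ?_)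
  rw [Fintype.card_fin, div_le_iff₀ (by positivity)]
  have hmean := mul_le_mul_of_nonneg_left (integral_numStored_runState_le θ hl)
    (Nat.cast_nonneg' θ.numMean)
  linarith

theorem measure_mean_far_le {c : ℝ} (hc : 0 < c)
    (hvar : 32 * Var[fun ω => (runState θ l ω l.length).R; runLaw θ (Fin l.length)] ≤
      θ.numMean * c ^ 2) :
    Measure.pi (fun _ : Fin θ.numMean => runLaw θ (Fin l.length))
      {y | c ≤ |(∑ j, (runState θ l (y j) l.length).R) / θ.numMean - G.numTriangles 1|} ≤
        ENNReal.ofReal (1 / 32) := by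
  have : NeZero θ.numMean := ⟨θ.numMean_pos.ne'⟩
  have hN : (0 : ℝ) < θ.numMean := Nat.cast_pos.2 θ.numMean_pos
  have hchebyshev := measure_pi_le_abs_mean_sub_integral (ι := Fin θ.numMean)
    (runLaw θ (Fin l.length)) (X := fun ω => (runState θ l ω l.length).R) .of_discrete hc
  rw [integral_R_runState θ hl, Fintype.card_fin] at hchebyshev
  refine hchebyshev.trans (ENNReal.ofReal_le_ofReal ?_)
  rw [div_le_iff₀ (by positivity)]
  linarith

theorem measure_groupMean_far_le {c : ℝ} (hc : 0 < c)
    (hvar : 32 * Var[fun ω => (runState θ l ω l.length).R; runLaw θ (Fin l.length)] ≤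
      θ.numMean * c ^ 2)
    (hbudget : 64 * (θ.numMean * (G.numEdges * (θ.pV * θ.pE))) ≤ θ.budget + 1) :
    Measure.pi (fun _ : Fin θ.numMean => runLaw θ (Fin l.length))
      {y | c < |groupMean (groupState θ l y l.length) - G.numTriangles 1|} ≤
        ENNReal.ofReal (1 / 4) ^ 2 := by
  have hcover : {y | c < |groupMean (groupState θ l y l.length) - G.numTriangles 1|} ⊆
      {y | θ.budget < ∑ j, (runState θ l (y j) l.length).numStored} ∪
        {y | c ≤ |(∑ j, (runState θ l (y j) l.length).R) / θ.numMean - G.numTriangles 1|} := by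
    intro y hy
    rw [Set.mem_ofPred_eq, groupState] at hy
    split_ifs at hy with h
    exacts [.inr hy.le, .inl (not_le.1 h)]
  calc _ ≤ ENNReal.ofReal (1 / 32) + ENNReal.ofReal (1 / 32) :=
        (measure_mono hcover).trans <| (measure_union_le _ _).trans <|
          add_le_add (measure_budget_lt_le θ hl hbudget) (measure_mean_far_le θ hl hc hvar)
    _ = ENNReal.ofReal (1 / 4) ^ 2 := by
        rw [← ENNReal.ofReal_add (by norm_num) (by norm_num), ← ENNReal.ofReal_pow (by norm_num)]
        norm_num

theorem le_outProb_medianOfMeans {c : ℝ} (hc : 0 < c)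
    (hvar : 32 * Var[fun ω => (runState θ l ω l.length).R; runLaw θ (Fin l.length)] ≤
      θ.numMean * c ^ 2)
    (hbudget : 64 * (θ.numMean * (G.numEdges * (θ.pV * θ.pE))) ≤ θ.budget + 1) :
    ENNReal.ofReal (1 - (1 / 2) ^ θ.numGroups) ≤
      (medianOfMeans θ).outProb (seedLaw θ) (coinLaw θ) l
        {R | |R - (G.numTriangles 1 : ℝ)| ≤ c} := by
  have : ({R | |R - (G.numTriangles 1 : ℝ)| ≤ c}).OrdConnected :=
    (convex_closedBall (G.numTriangles 1 : ℝ) c).ordConnected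
  have hmedian := measure_median_notMem_le (k := θ.numGroups) (r := .ofReal (1 / 4))
    (Measure.pi fun _ => runLaw θ (Fin l.length))
    (fun y => groupMean (groupState θ l y l.length)) (S := {R | |R - (G.numTriangles 1 : ℝ)| ≤ c})
    (ENNReal.ofReal_le_one.2 (by norm_num))
    (by simpa only [Set.mem_ofPred_eq, not_le] using measure_groupMean_far_le θ hl hc hvar hbudget)
  have hhalf : 2 * ENNReal.ofReal (1 / 4) = ENNReal.ofReal (1 / 2) := by
    rw [← ENNReal.ofReal_ofNat, ← ENNReal.ofReal_mul (by norm_num)]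
    norm_num
  rw [hhalf, ← ENNReal.ofReal_pow (by norm_num)] at hmedian
  rw [outProb_medianOfMeans, ENNReal.ofReal_sub _ (by positivity), ENNReal.ofReal_one]
  refine (tsub_le_tsub_left hmedian 1).trans (tsub_le_iff_right.2 ?_)
  exact (prob_add_prob_compl (Set.toFinite _).measurableSet).ge

end Accuracy

section PartialFunctions

variable {κ A : Type*} [Fintype κ] [Fintype A]

theorem sum_pow_ncard_support (x : ℝ) [DecidableEq κ] :
    ∑ f : κ → Option A, x ^ {k | f k ≠ none}.ncard = (1 + Fintype.card A * x) ^ Fintype.card κ := by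
  classical
  have hprod (f : κ → Option A) :
      x ^ {k | f k ≠ none}.ncard = ∏ k, if f k = none then 1 else x := by
    rw [Finset.prod_ite, Finset.prod_const_one, one_mul, Finset.prod_const,
      Set.ncard_eq_toFinset_card']
    congr 2
    ext k
    simp
  simp only [hprod]
  rw [← Fintype.piFinset_univ, ← Finset.prod_univ_sum (fun _ => Finset.univ)
    fun (_ : κ) (o : Option A) => if o = none then 1 else x]
  simp [Fintype.sum_option]

theorem card_support_le_mul_pow_le {x : ℝ} (hx : 0 ≤ x) (hx' : x ≤ 1) (B : ℕ) :
    (Nat.card {f : κ → Option A // {k | f k ≠ none}.ncard ≤ B} : ℝ) * x ^ B ≤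
      (1 + Fintype.card A * x) ^ Fintype.card κ := by
  classical
  rw [← sum_pow_ncard_support, Nat.card_eq_fintype_card, Fintype.card_subtype, ← nsmul_eq_mul,
    ← Finset.sum_const]
  calc ∑ f : κ → Option A with {k | f k ≠ none}.ncard ≤ B, x ^ B
      ≤ ∑ f : κ → Option A with {k | f k ≠ none}.ncard ≤ B, x ^ {k | f k ≠ none}.ncard :=
        Finset.sum_le_sum fun f hf => pow_le_pow_of_le_one hx hx' (Finset.mem_filter.1 hf).2
    _ ≤ ∑ f : κ → Option A, x ^ {k | f k ≠ none}.ncard :=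
        Finset.sum_le_sum_of_subset_of_nonneg (Finset.filter_subset _ _)
          fun _ _ _ => by positivity

theorem card_support_le_le [Nonempty A] {q N : ℕ} (hq : 0 < q) (hκ : Fintype.card κ ≤ q * N)
    (B : ℕ) :
    Nat.card {f : κ → Option A // {k | f k ≠ none}.ncard ≤ B} ≤
      (Fintype.card A * q) ^ B * 4 ^ N := by
  have hA : 0 < Fintype.card A := Fintype.card_pos
  -- The generating function of the support size, evaluated at `x`, is at most `exp N`.
  set x : ℝ := 1 / (Fintype.card A * q) with hx
  have hx' : x ≤ 1 := by
    rw [hx, div_le_one (by positivity)]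
    exact_mod_cast Nat.mul_pos hA hq
  have hAx : Fintype.card A * x = 1 / q := by
    rw [hx]
    field_simp
  have hpow : (1 + Fintype.card A * x) ^ Fintype.card κ ≤ 4 ^ N :=
    calc (1 + Fintype.card A * x) ^ Fintype.card κ
        ≤ (1 + 1 / (q : ℝ)) ^ (q * N) := by
          rw [hAx]
          exact pow_le_pow_right₀ (le_add_of_nonneg_right (by positivity)) hκ
      _ ≤ Real.exp (1 / q) ^ (q * N) := by
          gcongr
          linarith [Real.add_one_le_exp (1 / (q : ℝ))]
      _ = Real.exp 1 ^ N := by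
          rw [pow_mul, ← Real.exp_nat_mul, mul_one_div_cancel (by positivity)]
      _ ≤ 4 ^ N := by
          gcongr
          linarith [Real.exp_one_lt_three]
  have hcard := (card_support_le_mul_pow_le (κ := κ) (A := A) (by positivity) hx' B).trans hpow
  rw [hx, one_div, inv_pow, ← div_eq_mul_inv, div_le_iff₀ (by positivity), mul_comm] at hcard
  exact_mod_cast hcard

end PartialFunctions

section MemoryStates

theorem StreamAlg.usesAtMostBits_of_card_le {α Seed Coin Mem X : Type} [Finite X]
    (A : StreamAlg α Seed Coin Mem) {P : Set (List α)} {b : ℕ} (decode : X → Mem)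
    (hdecode : A.reachable P ⊆ Set.range decode) (hX : Nat.card X ≤ 2 ^ b) :
    A.UsesAtMostBits P b := by
  have := Fintype.ofFinite X
  have ⟨e⟩ := Function.Embedding.nonempty_of_card_le (α := X) (β := Fin b → Bool)
    (by simpa using hX)
  cases isEmpty_or_nonempty X
  · exact ⟨fun _ _ => false, fun M hM => isEmptyElim (hdecode hM).choose⟩
  refine ⟨fun M => e (Function.invFun decode M), fun M hM M' hM' h => ?_⟩
  rw [← Function.invFun_eq (hdecode hM), ← Function.invFun_eq (hdecode hM'), e.injective h]

variable {n : ℕ} (θ : Params n)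

theorem card_sym2_fin_le (n : ℕ) : Fintype.card (Sym2 (Fin n)) ≤ n ^ 2 := by
  simpa [sq] using Fintype.card_le_of_surjective _ (Sym2.mk_surjective (α := Fin n))

theorem IsStreamOf.length_le {l : List (SignedEdge n)} {G : SignedGraph n}
    (hl : IsStreamOf l G) : l.length ≤ n ^ 2 := by
  simpa using hl.1.length_le_card.trans (card_sym2_fin_le n)

theorem exists_R_runState_eq (l : List (SignedEdge n))
    (ω : Fin θ.numSeeds × (Fin l.length → Bool)) :
    ∃ r ≤ l.length * n, (runState θ l ω l.length).R = r * (1 / (θ.pV * θ.pE ^ 2)) := by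
  refine ⟨∑ i : Fin l.length, (detected (runState θ l ω i) (l.get i)).ncard, ?_, ?_⟩
  · simpa [-List.get_eq_getElem] using Finset.sum_le_card_nsmul
      (Finset.univ : Finset (Fin l.length)) _ n fun i _ =>
        (Set.ncard_le_card (detected (runState θ l ω i) (l.get i))).trans_eq (by simp)
  · rw [runState_R_eq_sum, Nat.cast_sum]

/-- A code for the memory of a group: whether it is abandoned and, if not, the hash indices of its
runs, their numbers (below `K`) of detected triangles, and all their dictionaries, taken together
as a single one with at most `budget` entries. -/
abbrev GroupCode (K : ℕ) : Type :=
  Option ((Fin θ.numMean → Fin θ.numSeeds × Fin K) ×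
    {S : Fin θ.numMean × Sym2 (Fin n) → Option ℤˣ // {x | S x ≠ none}.ncard ≤ θ.budget})

/-- The memory of a group with the given code; the estimate of a run is recovered from its number
of detected triangles. -/
noncomputable def GroupCode.decode {K : ℕ} : GroupCode θ K → GroupMem θ :=
  Option.map fun x j =>
    ⟨(x.1 j).1, ((x.1 j).2 : ℕ) * (1 / (θ.pV * θ.pE ^ 2)), fun e => x.2.1 (j, e)⟩

theorem groupState_mem_range_decode {l : List (SignedEdge n)} {K : ℕ} (hK : l.length * n < K)
    (y : Fin θ.numMean → Fin θ.numSeeds × (Fin l.length → Bool)) :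
    groupState θ l y l.length ∈ Set.range (GroupCode.decode θ (K := K)) := by
  classical
  rw [groupState]
  split_ifs with hbudget
  · choose r hr hR using fun j => exists_R_runState_eq θ l (y j)
    have hS : {x : Fin θ.numMean × Sym2 (Fin n) |
        (runState θ l (y x.1) l.length).S x.2 ≠ none}.ncard ≤ θ.budget := by
      refine hbudget.trans_eq' ?_
      simp only [EstMem.numStored, Set.ncard_eq_toFinset_card', Set.toFinset_ofPred,
        Finset.card_filter, Fintype.sum_prod_type]
    refine ⟨some (fun j => ((y j).1, ⟨r j, (hr j).trans_lt hK⟩), ⟨_, hS⟩), ?_⟩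
    simp only [GroupCode.decode, Option.map_some, ← hR]
    exact congrArg some (funext fun j => congrArg (EstMem.mk · _ _) (runState_seed _ _).symm)
  · exact ⟨none, rfl⟩

theorem card_groupCode_le {a : ℕ} (hn : n ≤ 2 ^ a) (hseeds : θ.numSeeds = 2 ^ a * 2 ^ a) :
    Nat.card (GroupCode θ (2 ^ (3 * a + 1))) ≤ 2 ^ ((θ.numMean + θ.budget) * (5 * a + 4)) := by
  have hdict : Nat.card {S : Fin θ.numMean × Sym2 (Fin n) → Option ℤˣ //
      {x | S x ≠ none}.ncard ≤ θ.budget} ≤ (2 * (2 ^ a) ^ 2) ^ θ.budget * 4 ^ θ.numMean := by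
    have hκ : Fintype.card (Fin θ.numMean × Sym2 (Fin n)) ≤ (2 ^ a) ^ 2 * θ.numMean := by
      rw [Fintype.card_prod, Fintype.card_fin, mul_comm]
      gcongr
      exact (card_sym2_fin_le n).trans (by gcongr)
    simpa using card_support_le_le (A := ℤˣ) (by positivity) hκ θ.budget
  have hsome : Nat.card ((Fin θ.numMean → Fin θ.numSeeds × Fin (2 ^ (3 * a + 1))) ×
      {S : Fin θ.numMean × Sym2 (Fin n) → Option ℤˣ // {x | S x ≠ none}.ncard ≤ θ.budget}) ≤
      2 ^ ((5 * a + 3) * θ.numMean + (2 * a + 1) * θ.budget) := by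
    rw [Nat.card_prod]
    simp only [Nat.card_fun, Nat.card_prod, Nat.card_fin, hseeds]
    refine (Nat.mul_le_mul_left _ hdict).trans_eq ?_
    rw [show 4 = 2 ^ 2 from rfl]
    simp only [← pow_mul, ← pow_add, ← pow_succ']
    ring_nf
  rw [Finite.card_option]
  calc _ ≤ 2 ^ ((5 * a + 3) * θ.numMean + (2 * a + 1) * θ.budget) + 1 := by gcongr
    _ ≤ 2 ^ ((5 * a + 3) * θ.numMean + (2 * a + 1) * θ.budget + 1) := by
        rw [pow_succ, mul_two]
        gcongr
        exact Nat.one_le_two_pow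
    _ ≤ 2 ^ ((θ.numMean + θ.budget) * (5 * a + 4)) := by
        gcongr
        · norm_num
        · nlinarith [θ.numMean_pos]

theorem usesAtMostBits_medianOfMeans {a : ℕ} (hn : n ≤ 2 ^ a)
    (hseeds : θ.numSeeds = 2 ^ a * 2 ^ a) (S : Set (SignedGraph n)) :
    (medianOfMeans θ).UsesAtMostBits {l | ∃ G ∈ S, IsStreamOf l G}
      (θ.numGroups * ((θ.numMean + θ.budget) * (5 * a + 4))) := by
  refine StreamAlg.usesAtMostBits_of_card_le _
    (fun (x : Fin θ.numGroups → GroupCode θ (2 ^ (3 * a + 1))) g => (x g).decode) ?_ ?_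
  · rintro _ ⟨l, ⟨G, -, hl⟩, l', hprefix, k, c, rfl⟩
    have hdetected : l'.length * n < 2 ^ (3 * a + 1) :=
      calc l'.length * n ≤ n ^ 2 * n := by
            gcongr
            exact hprefix.length_le.trans hl.length_le
        _ ≤ (2 ^ a) ^ 2 * 2 ^ a := by gcongr
        _ = 2 ^ (3 * a) := by ring
        _ < 2 ^ (3 * a + 1) := by gcongr <;> norm_num
    choose x hx using fun g =>
      groupState_mem_range_decode θ hdetected fun j => (k g j, fun i => c i g j)
    exact ⟨x, by rw [medianOfMeans_run]; exact funext hx⟩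
  · rw [Nat.card_fun, Nat.card_fin, mul_comm θ.numGroups, pow_mul]
    exact Nat.pow_le_pow_left (card_groupCode_le θ hn hseeds) _

end MemoryStates

section Parameters

theorem exists_mul_div_mem_Icc {Q : ℝ} {q : ℕ} (hq : 0 < q) (hQ : 1 / q ≤ Q) :
    ∃ k N : ℕ, 0 < k ∧ k ≤ q ∧ 0 < N ∧ (N : ℝ) ≤ Q + 1 ∧
      Q ≤ N * (k / q : ℝ) ∧ N * (k / q : ℝ) ≤ 2 * Q := by
  have hq' : (0 : ℝ) < q := Nat.cast_pos.2 hq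
  have hQ0 : 0 < Q := (by positivity : (0 : ℝ) < 1 / q).trans_le hQ
  rcases le_or_gt Q 1 with hQ1 | hQ1
  · have hceil := Nat.ceil_lt_add_one (mul_pos hQ0 hq').le
    refine ⟨⌈Q * q⌉₊, 1, Nat.ceil_pos.2 (mul_pos hQ0 hq'), ?_, one_pos, by simpa using hQ0.le,
      ?_, ?_⟩
    · rw [Nat.ceil_le]
      nlinarith
    · rw [Nat.cast_one, one_mul, le_div_iff₀ hq']
      exact Nat.le_ceil _
    · rw [div_le_iff₀ hq'] at hQ
      rw [Nat.cast_one, one_mul, div_le_iff₀ hq']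
      linarith
  · have hceil := Nat.ceil_lt_add_one hQ0.le
    refine ⟨q, ⌈Q⌉₊, hq, le_rfl, Nat.ceil_pos.2 hQ0, hceil.le, ?_, ?_⟩ <;>
      rw [div_self hq'.ne', mul_one]
    · exact Nat.le_ceil _
    · linarith

theorem exists_half_pow_le {δ : ℝ} (hδ : 0 < δ) (hδ' : δ ≤ 1 / 2) :
    ∃ M : ℕ, 0 < M ∧ (M : ℝ) ≤ 3 * Real.log (1 / δ) ∧ (1 / 2 : ℝ) ^ M ≤ δ := by
  have hlog2 := Real.log_two_gt_d9
  have hlog : Real.log 2 ≤ Real.log (1 / δ) := by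
    refine Real.log_le_log two_pos ?_
    rw [le_div_iff₀ hδ]
    linarith
  have hpos : 0 < Real.log (1 / δ) / Real.log 2 := by
    apply div_pos <;> linarith
  refine ⟨⌈Real.log (1 / δ) / Real.log 2⌉₊, Nat.ceil_pos.2 hpos, ?_, ?_⟩
  · have hceil := Nat.ceil_lt_add_one hpos.le
    have hle : Real.log (1 / δ) / Real.log 2 ≤ 1.5 * Real.log (1 / δ) := by
      rw [div_le_iff₀ (by linarith)]
      nlinarith
    linarith
  · have hceil := Nat.le_ceil (Real.log (1 / δ) / Real.log 2)
    rw [div_le_iff₀ (by linarith)] at hceil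
    rwa [one_div, inv_pow, inv_le_comm₀ (by positivity) hδ,
      ← Real.log_le_log_iff (by positivity) (by positivity), Real.log_pow, ← one_div]

theorem exists_le_two_pow {n : ℕ} (hn : 3 ≤ n) :
    ∃ a : ℕ, n ≤ 2 ^ a ∧ (5 * a + 4 : ℝ) ≤ 17 * Real.log n := by
  refine ⟨Nat.log 2 n + 1, (Nat.lt_pow_succ_log_self one_lt_two n).le, ?_⟩
  have hn' : (3 : ℝ) ≤ n := by exact_mod_cast hn
  have hlogn : 1 ≤ Real.log n := by
    rw [Real.le_log_iff_exp_le (by linarith)]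
    linarith [Real.exp_one_lt_three]
  have hlog : (Nat.log 2 n : ℝ) * Real.log 2 ≤ Real.log n := by
    rw [← Real.log_pow]
    refine Real.log_le_log (by positivity) ?_
    exact_mod_cast Nat.pow_log_le_self 2 (by omega)
  have hle : (Nat.log 2 n : ℝ) ≤ 1.5 * Real.log n := by
    nlinarith [Real.log_two_gt_d9, (Nat.cast_nonneg (Nat.log 2 n) : (0 : ℝ) ≤ _)]
  push_cast
  linarith

variable {n m T DE DV : ℕ} {ε s : ℝ}

theorem three_le_of_numTriangles_pos {G : SignedGraph n} (h : 0 < G.numTriangles 1) : 3 ≤ n := by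
  obtain ⟨t, ht, -⟩ := (Set.ncard_pos (Set.toFinite _)).1 h
  have hclique : G.graph.IsNClique 3 t := ht
  simpa [hclique.card_eq] using Finset.card_le_univ t

theorem le_of_boundedGraphs_nonempty (h : (boundedGraphs n m T DE DV).Nonempty) :
    T ≤ m * DE ∧ T ≤ n * min DV m := by
  obtain ⟨G, hm, hT, hE, hV⟩ := h
  obtain ⟨l, hl⟩ := G.exists_isStreamOf
  exact ⟨hT.trans (hl.numTriangles_le_numEdges_mul.trans (Nat.mul_le_mul hm hE)),
    hT.trans (hl.numTriangles_le_mul_min.trans (Nat.mul_le_mul_left n (min_le_min hV hm)))⟩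

theorem variance_R_runState_le_of_mem_boundedGraphs (θ : Params n) (hs : 0 < s)
    (hsd : (min DV m : ℕ) ≤ s ^ 2) (hpE : θ.pE = 1 / s) {G : SignedGraph n}
    (hG : G ∈ boundedGraphs n m T DE DV) {l : List (SignedEdge n)} (hl : IsStreamOf l G) :
    Var[fun ω => (runState θ l ω l.length).R; runLaw θ (Fin l.length)] ≤
      2 * (s * (DE + s)) * G.numTriangles 1 / θ.pV := by
  obtain ⟨hGm, -, hGE, hGV⟩ := hG
  have hpV := θ.pV_pos
  have hmin : (min G.maxTrianglesAtVertex G.numEdges : ℕ) ≤ s ^ 2 :=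
    hsd.trans' (by exact_mod_cast min_le_min hGV hGm)
  calc Var[fun ω => (runState θ l ω l.length).R; runLaw θ (Fin l.length)]
      ≤ G.numTriangles 1 * ((min G.maxTrianglesAtVertex G.numEdges : ℕ) / θ.pV +
          2 * G.maxTrianglesAtEdge / (θ.pV * θ.pE) + 1 / (θ.pV * θ.pE ^ 2)) :=
        variance_R_runState_le θ hl
    _ ≤ G.numTriangles 1 * (s ^ 2 / θ.pV + 2 * DE / (θ.pV * (1 / s)) +
          1 / (θ.pV * (1 / s) ^ 2)) := by
        rw [hpE]
        gcongr
    _ = 2 * (s * (DE + s)) * G.numTriangles 1 / θ.pV := by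
        field_simp
        ring

theorem le_outProb_medianOfMeans_of_mem_boundedGraphs (θ : Params n) (hT : 0 < T) (hε : 0 < ε)
    (hs : 0 < s) (hsd : (min DV m : ℕ) ≤ s ^ 2) (hpE : θ.pE = 1 / s)
    (hN : 64 * (s * (DE + s)) / (ε ^ 2 * T) ≤ θ.numMean * θ.pV)
    (hB : 64 * (θ.numMean * (m * (θ.pV * θ.pE))) ≤ θ.budget + 1) {G : SignedGraph n}
    (hG : G ∈ boundedGraphs n m T DE DV) {l : List (SignedEdge n)} (hl : IsStreamOf l G) :
    ENNReal.ofReal (1 - (1 / 2) ^ θ.numGroups) ≤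
      (medianOfMeans θ).outProb (seedLaw θ) (coinLaw θ) l
        {R | |R - G.numTriangles 1| ≤ ε * G.numTriangles 1} := by
  have hpV := θ.pV_pos
  have hpE' := θ.pE_pos
  have hTt : (T : ℝ) ≤ G.numTriangles 1 := Nat.cast_le.2 hG.2.1
  have hT' : (0 : ℝ) < T := Nat.cast_pos.2 hT
  have hGm : (G.numEdges : ℝ) ≤ m := Nat.cast_le.2 hG.1
  refine le_outProb_medianOfMeans θ hl (mul_pos hε (hT'.trans_le hTt)) ?_ (hB.trans' (by gcongr))
  rw [div_le_iff₀ (by positivity)] at hN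
  calc 32 * Var[fun ω => (runState θ l ω l.length).R; runLaw θ (Fin l.length)]
      ≤ 32 * (2 * (s * (DE + s)) * G.numTriangles 1 / θ.pV) := by
        gcongr
        exact variance_R_runState_le_of_mem_boundedGraphs θ hs hsd hpE hG hl
    _ = 64 * (s * (DE + s)) * G.numTriangles 1 / θ.pV := by ring
    _ ≤ θ.numMean * θ.pV * (ε ^ 2 * T) * G.numTriangles 1 / θ.pV := by gcongr
    _ = θ.numMean * (ε ^ 2 * T * G.numTriangles 1) := by field_simp
    _ ≤ θ.numMean * (ε ^ 2 * G.numTriangles 1 * G.numTriangles 1) := by gcongr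
    _ = θ.numMean * (ε * G.numTriangles 1) ^ 2 := by ring

theorem one_div_le_sampling_rate {q : ℕ} (hn : n ≤ q) (hT : 0 < T) (hε : 0 < ε) (hε' : ε ≤ 1)
    (hs : 0 < s) (hTn : (T : ℝ) ≤ n * s ^ 2) :
    1 / (q : ℝ) ≤ 64 * (s * (DE + s)) / (ε ^ 2 * T) := by
  have hT' : (0 : ℝ) < T := Nat.cast_pos.2 hT
  have hnq : (n : ℝ) ≤ q := Nat.cast_le.2 hn
  have hε2 : ε ^ 2 ≤ 1 := pow_le_one₀ hε.le hε'
  have hq : (0 : ℝ) < q := by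
    rcases Nat.eq_zero_or_pos n with rfl | hn0
    · rw [Nat.cast_zero, zero_mul] at hTn
      exact absurd hT' hTn.not_gt
    · exact_mod_cast hn0.trans_le hn
  rw [div_le_div_iff₀ hq (by positivity)]
  calc 1 * (ε ^ 2 * T) ≤ 1 * (1 * (q * s ^ 2)) := by
        gcongr
        exact hTn.trans (by gcongr)
    _ = s * s * q := by ring
    _ ≤ 64 * (s * (DE + s)) * q := by
        refine mul_le_mul_of_nonneg_right ?_ hq.le
        nlinarith [mul_nonneg hs.le (Nat.cast_nonneg (α := ℝ) DE), mul_pos hs hs]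

theorem numMean_add_floor_le {N : ℕ} {p : ℝ} (hT : 0 < T) (hε : 0 < ε) (hε' : ε ≤ 1) (hs : 0 < s)
    (hsm : s ≤ m) (hTm : (T : ℝ) ≤ m * DE) (hp : 0 < p)
    (hN : (N : ℝ) ≤ 64 * (s * (DE + s)) / (ε ^ 2 * T) + 1)
    (hNp : N * p ≤ 2 * (64 * (s * (DE + s)) / (ε ^ 2 * T))) :
    N + (⌊64 * (N * (m * (p * (1 / s))))⌋₊ : ℝ) ≤
      8257 * ((m : ℝ) / T * (DE + s) * (1 / ε ^ 2)) := by
  have hε2 : ε ^ 2 ≤ 1 := pow_le_one₀ hε.le hε'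
  have hone : 1 ≤ (m : ℝ) / T * (DE + s) * (1 / ε ^ 2) := by
    rw [← div_eq_mul_one_div, div_mul_eq_mul_div, div_div, one_le_div (by positivity)]
    nlinarith
  have hrate : 64 * (s * (DE + s)) / (ε ^ 2 * T) ≤
      64 * ((m : ℝ) / T * (DE + s) * (1 / ε ^ 2)) :=
    calc 64 * (s * (DE + s)) / (ε ^ 2 * T) ≤ 64 * (m * (DE + s)) / (ε ^ 2 * T) := by gcongr
      _ = 64 * ((m : ℝ) / T * (DE + s) * (1 / ε ^ 2)) := by field_simp
  have hfloor : (⌊64 * (N * (m * (p * (1 / s))))⌋₊ : ℝ) ≤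
      8192 * ((m : ℝ) / T * (DE + s) * (1 / ε ^ 2)) :=
    calc (⌊64 * (N * (m * (p * (1 / s))))⌋₊ : ℝ) ≤ 64 * (N * (m * (p * (1 / s)))) :=
          Nat.floor_le (by positivity)
      _ = 64 * (m / s) * (N * p) := by ring
      _ ≤ 64 * (m / s) * (2 * (64 * (s * (DE + s)) / (ε ^ 2 * T))) := by gcongr
      _ = 8192 * ((m : ℝ) / T * (DE + s) * (1 / ε ^ 2)) := by
          field_simp
          ring
  linarith

theorem exists_sampling_params {a M : ℕ} (ha : a ≠ 0) (hn : n ≤ 2 ^ a) (hM : 0 < M) (hT : 0 < T)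
    (hε : 0 < ε) (hε' : ε ≤ 1) (hs : 1 ≤ s) (hsm : s ≤ m) (hTm : (T : ℝ) ≤ m * DE)
    (hTn : (T : ℝ) ≤ n * s ^ 2) :
    ∃ θ : Params n, θ.pE = 1 / s ∧ θ.numSeeds = 2 ^ a * 2 ^ a ∧ θ.numGroups = M ∧
      64 * (s * (DE + s)) / (ε ^ 2 * T) ≤ θ.numMean * θ.pV ∧
      64 * (θ.numMean * (m * (θ.pV * θ.pE))) ≤ θ.budget + 1 ∧
      (θ.numMean + θ.budget : ℝ) ≤ 8257 * ((m : ℝ) / T * (DE + s) * (1 / ε ^ 2)) := by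
  have hs0 : 0 < s := one_pos.trans_le hs
  obtain ⟨k, N, hk, hk', hN, hNQ, hQN, hNQ'⟩ := exists_mul_div_mem_Icc (Nat.two_pow_pos a)
    (one_div_le_sampling_rate (DE := DE) hn hT hε hε' hs0 hTn)
  obtain ⟨θ, hpV, hpE, hseeds, hmean, hgroups, hbudget⟩ := exists_params ha hn hk hk'
    (one_div_pos.2 hs0) (div_le_one_of_le₀ hs hs0.le) hN hM
    ⌊64 * (N * (m * (k / (2 ^ a : ℕ) * (1 / s))))⌋₊
  push_cast at hbudget hNQ' hQN
  refine ⟨θ, hpE, hseeds, hgroups, ?_, ?_, ?_⟩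
  · rwa [hmean, hpV]
  · rw [hmean, hpV, hpE, hbudget]
    exact (Nat.lt_floor_add_one _).le
  · rw [hmean, hbudget]
    exact numMean_add_floor_le hT hε hε' hs0 hsm hTm (by positivity) hNQ hNQ'

theorem exists_params_of_boundedGraphs_nonempty {δ : ℝ} (hT : 0 < T) (hε : 0 < ε)
    (hε' : ε ≤ 1) (hδ : 0 < δ) (hδ' : δ ≤ 1 / 2) (hne : (boundedGraphs n m T DE DV).Nonempty) :
    ∃ (θ : Params n) (b : ℕ),
      (b : ℝ) ≤ 3 * 17 * 8257 * ((m : ℝ) / T * (DE + Real.sqrt DV) * Real.log n * (1 / ε ^ 2)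
        * Real.log (1 / δ)) ∧
      (medianOfMeans θ).UsesAtMostBits
        {l | ∃ G ∈ boundedGraphs n m T DE DV, IsStreamOf l G} b ∧
      ∀ G ∈ boundedGraphs n m T DE DV, ∀ l : List (SignedEdge n), IsStreamOf l G →
        ENNReal.ofReal (1 - δ) ≤ (medianOfMeans θ).outProb (seedLaw θ) (coinLaw θ) l
          {R | |R - (G.numTriangles 1 : ℝ)| ≤ ε * (G.numTriangles 1 : ℝ)} := by
  obtain ⟨hTm, hTn⟩ := le_of_boundedGraphs_nonempty hne
  have hn : 3 ≤ n := three_le_of_numTriangles_pos (hT.trans_le hne.some_mem.2.1)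
  have hd : 1 ≤ min DV m := Nat.pos_of_mul_pos_left (hT.trans_le hTn)
  obtain ⟨M, hM, hMlog, hMδ⟩ := exists_half_pow_le hδ hδ'
  obtain ⟨a, hna, halog⟩ := exists_le_two_pow hn
  have ha : a ≠ 0 := by
    rintro rfl
    omega
  set s : ℝ := Real.sqrt (min DV m : ℕ)
  have hsd : s ^ 2 = (min DV m : ℕ) := Real.sq_sqrt (Nat.cast_nonneg _)
  have hs : 1 ≤ s := Real.one_le_sqrt.2 (by exact_mod_cast hd)
  have hsDV : s ≤ Real.sqrt DV := Real.sqrt_le_sqrt (by exact_mod_cast min_le_left _ _)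
  have hsm : s ≤ m := by
    have : ((min DV m : ℕ) : ℝ) ≤ m := by exact_mod_cast min_le_right _ _
    nlinarith
  obtain ⟨θ, hpE, hseeds, hgroups, hN, hB, hNB⟩ := exists_sampling_params ha hna hM hT hε hε' hs
    hsm (by exact_mod_cast hTm) (hsd ▸ by exact_mod_cast hTn)
  refine ⟨θ, _, ?_, usesAtMostBits_medianOfMeans θ hna hseeds _, fun G hG l hl => ?_⟩
  · have hlogδ : 0 ≤ Real.log (1 / δ) := by linarith [Nat.cast_nonneg (α := ℝ) M]
    rw [hgroups]
    push_cast
    calc (M : ℝ) * ((θ.numMean + θ.budget) * (5 * a + 4))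
        ≤ 3 * Real.log (1 / δ) * (8257 * ((m : ℝ) / T * (DE + Real.sqrt DV) * (1 / ε ^ 2)) *
            (17 * Real.log n)) := by
          gcongr
          exact hNB.trans (by gcongr)
      _ = _ := by ring
  · refine le_trans (ENNReal.ofReal_le_ofReal ?_) (le_outProb_medianOfMeans_of_mem_boundedGraphs θ
      hT hε (one_pos.trans_le hs) hsd.ge hpE hN hB hG hl)
    rw [hgroups]
    linarith

end Parameters

end SignedStream

theorem mainTheorem5 :
    ∃ C : ℝ, 0 < C ∧
      ∀ (n m T DE DV : ℕ) (ε δ : ℝ), 0 < T → 0 < ε → ε ≤ 1 → 0 < δ → δ ≤ 1 / 2 →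
        ∃ (θ : SignedStream.Params n) (b : ℕ),
          (b : ℝ) ≤ C * ((m : ℝ) / T * (DE + Real.sqrt DV) * Real.log n * (1 / ε ^ 2)
            * Real.log (1 / δ)) ∧
          (SignedStream.medianOfMeans θ).UsesAtMostBits
            {l | ∃ G ∈ SignedStream.boundedGraphs n m T DE DV, SignedStream.IsStreamOf l G} b ∧
          ∀ G ∈ SignedStream.boundedGraphs n m T DE DV,
            ∀ l : List (SignedStream.SignedEdge n), SignedStream.IsStreamOf l G →
              ENNReal.ofReal (1 - δ) ≤
                (SignedStream.medianOfMeans θ).outProb (SignedStream.seedLaw θ)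
                  (SignedStream.coinLaw θ) l
                  {R | |R - (G.numTriangles 1 : ℝ)| ≤ ε * (G.numTriangles 1 : ℝ)} := by
  refine ⟨3 * 17 * 8257, by norm_num, fun n m T DE DV ε δ hT hε hε' hδ hδ' => ?_⟩
  rcases (SignedStream.boundedGraphs n m T DE DV).eq_empty_or_nonempty with hempty | hne
  · have hlogδ : 0 ≤ Real.log (1 / δ) :=
      Real.log_nonneg (one_le_one_div hδ (hδ'.trans (by norm_num)))
    refine ⟨default, 0, by rw [Nat.cast_zero]; positivity, ⟨fun _ _ => false, ?_⟩, ?_⟩ <;>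
      simp [hempty, SignedStream.StreamAlg.reachable]
  · exact SignedStream.exists_params_of_boundedGraphs_nonempty hT hε hε' hδ hδ' hne
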